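/- **Setting.** Let $\mathbb R_5$ be the real Clifford algebra with units $e_1,\dots,e_5$, $e_ie_j+e_je_i=-2\delta_{ij}$, and basis $e_A$, $A\subseteq\{1,\dots,5\}$. Identify $x\in\mathbb R^6$ with the paravector $x_0+\sum_{j=1}^5x_je_j$; let $\mathbb S=\{x\in\mathbb R^6: x_0=0,\ |x|=1\}$ and, for $J\in\mathbb S$, $\mathbb C_J=\{u+Jv:u,v\in\mathbb R\}\cong\mathbb C$. A set $U\subseteq\mathbb R^6$ is *axially symmetric* if $u+Iv\in U$ for some $I\in\mathbb S$ implies $u+Jv\in U$ for all $J\in\mathbb S$. An axially symmetric open set $U$ is a *slice Cauchy domain* if for every $J\in\mathbb S$ the boundary of $U\cap\mathbb C_J$ in $\mathbb C_J$ is the union of finitely many pairwise disjoint piecewise continuously differentiable Jordan curves. Integrals over $\partial(U\cap\mathbb C_J)$ are taken over the positively oriented boundary, i.e. the curves are oriented so that their total winding number is $1$ around each point of $U\cap\mathbb C_J$ and $0$ around each point of $\mathbb C_J\setminus\overline{U\cap\mathbb C_J}$; and $ds_J=ds\,(-J)$. Let $W\subseteq\mathbb R^6$ be open and axially symmetric.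 A function $f:W\to\mathbb R_5$ is *left* (resp. *right*) *slice hyperholomorphic* on $W$ if $f(u+Jv)=\alpha(u,v)+J\beta(u,v)$ (resp. $\alpha(u,v)+\beta(u,v)J$) for all $J\in\mathbb S$, with differentiable $\mathbb R_5$-valued $\alpha,\beta$ such that $\alpha(u,v)=\alpha(u,-v)$, $\beta(u,v)=-\beta(u,-v)$, $\partial_u\alpha=\partial_v\beta$, $\partial_v\alpha=-\partial_u\beta$. Let $V$ be a real Banach space, $V_5=V\otimes\mathbb R_5$ with norm $\|\sum_Av_Ae_A\|=\sum_A\|v_A\|$, and let $\mathcal B(V_5)$ be the set of operators $\sum_AT_Ae_A$, $T_A\in\mathcal B(V)$, acting by $\sum_Bv_Be_B\mapsto\sum_{A,B}T_A(v_B)e_Ae_B$; elements of $\mathbb R_5$ act on $V_5$ by left multiplication. Let $T=T_0+\sum_{j=1}^5e_jT_j\in\mathcal{BC}^{0,1}(V_5)$, i.e. $T_0,\dots,T_5\in\mathcal B(V)$ commute pairwise, and put $\overline T=T_0-\sum_{j=1}^5e_jT_j$, $\mathcal Q_s(T)=s^2\mathcal I-s(T+\overline T)+T\overline T$ for $s\in\mathbb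 R^6$, and $$\sigma_S(T)=\{s\in\mathbb R^6:\ \mathcal Q_s(T)\text{ is not invertible in }\mathcal B(V_5)\}.$$ For $s\notin\sigma_S(T)$ write $\mathcal Q=\mathcal Q_s(T)$, $S_L^{-1}(s,T)=(s-\overline T)\mathcal Q^{-1}$, $S_R^{-1}(s,T)=\mathcal Q^{-1}(s-\overline T)$ (note $\mathcal Q_s(\overline T)=\mathcal Q_s(T)$), and define the left and right resolvent operators $S^{-1}_{P,L}(s,T)$, $S^{-1}_{P,R}(s,T)$ for $P\in\{\mathcal D,\Delta,\Delta\mathcal D,\overline{\mathcal D},\overline{\mathcal D}^2,\mathcal D^2,\Delta\overline{\mathcal D}\}$ by | $P$ | $S^{-1}_{P,L}(s,T)$ | $S^{-1}_{P,R}(s,T)$ | |---|---|---| | $\mathcal D$ | $-4\mathcal Q^{-1}$ | $-4\mathcal Q^{-1}$ | | $\Delta$ | $-8S_L^{-1}(s,T)\mathcal Q^{-1}$ | $-8\mathcal Q^{-1}S_R^{-1}(s,T)$ | | $\Delta\mathcal D$ | $16\mathcal Q^{-2}$ | $16\mathcal Q^{-2}$ | | $\overline{\mathcal D}$ | $4(s-\overline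 T)\mathcal Q^{-2}(s-T_0)+2\mathcal Q^{-1}$ | $4(s-T_0)\mathcal Q^{-2}(s-\overline T)+2\mathcal Q^{-1}$ | | $\overline{\mathcal D}^2$ | $32(s-\overline T)\mathcal Q^{-3}(s-T_0)^2$ | $32(s-T_0)^2\mathcal Q^{-3}(s-\overline T)$ | | $\mathcal D^2$ | $8S_L^{-1}(s,\overline T)\mathcal Q^{-1}$ | $8\mathcal Q^{-1}S_R^{-1}(s,\overline T)$ | | $\Delta\overline{\mathcal D}$ | $-64(s-\overline T)\mathcal Q^{-3}(s-T_0)$ | $-64(s-T_0)\mathcal Q^{-3}(s-\overline T)$ | **Theorem.** Let $T\in\mathcal{BC}^{0,1}(V_5)$, let $P$ be one of the seven symbols above, and let $W\subseteq\mathbb R^6$ be open and axially symmetric. 1. If $f$ is left slice hyperholomorphic on $W$, then for every bounded slice Cauchy domain $U$ with $\sigma_S(T)\subset U$ and $\overline U\subset W$ and every $J\in\mathbb S$ the integral $$\frac1{2\pi}\int_{\partial(U\cap\mathbb C_J)}S^{-1}_{P,L}(s,T)\,ds_J\,f(s)$$ exists, and its value depends neither on $U$ nor on $J$. 2. If $f$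 is right slice hyperholomorphic on $W$, then for every such $U$ and $J$ the integral $$\frac1{2\pi}\int_{\partial(U\cap\mathbb C_J)}f(s)\,ds_J\,S^{-1}_{P,R}(s,T)$$ exists, and its value depends neither on $U$ nor on $J$. Hence the functional calculi of the fine structure in dimension five, which these integrals define, are well defined. -/

import Mathlib

noncomputable section

/-! ### The Clifford algebra `ℝ₅` and the module `V₅ = V ⊗ ℝ₅` -/

namespace FineStructure

/-- `V₅ = V ⊗ ℝ₅`: the elements are `∑_A v_A e_A` with `A ⊆ {1,…,5}` and `v_A ∈ V`, with the norm
`∑_A ‖v_A‖`. (`Fin 5 = {0,…,4}` indexes the units `e_1,…,e_5`.) -/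
abbrev V5 (V : Type*) := PiLp 1 (fun _ : Finset (Fin 5) => V)

/-- The Clifford algebra `ℝ₅`, with elements `∑_A x_A e_A`, `x_A ∈ ℝ`. Its product is `Cl5.mul`. -/
abbrev Cl5 := V5 ℝ

/-- The sign in `e_A e_B = sgn A B • e_{A ∆ B}`: a factor `-1` for every transposition
`e_i e_j = - e_j e_i` (`i ∈ A`, `j ∈ B`, `j < i`) that is needed to sort the product, and a factor
`-1` for every `e_i ^ 2 = -1` (`i ∈ A ∩ B`). -/
def sgn (A B : Finset (Fin 5)) : ℝ :=
  ∏ i ∈ A, ∏ j ∈ B, if j ≤ i then -1 else 1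

section Module

variable {V : Type*} [NormedAddCommGroup V] [NormedSpace ℝ V]

/-- Left multiplication `v ↦ a v` by `a ∈ ℝ₅` on `V₅`:
`(∑_A a_A e_A) (∑_B v_B e_B) = ∑_{A,B} a_A v_B e_A e_B`. The coefficient at `e_C` collects the pairs
`(A, B)` with `A ∆ B = C`, that is `B = A ∆ C`. -/
def lmul (a : Cl5) : V5 V →L[ℝ] V5 V :=
  (PiLp.continuousLinearEquiv 1 ℝ (fun _ : Finset (Fin 5) => V)).symm.toContinuousLinearMap ∘L
    ContinuousLinearMap.pi fun C : Finset (Fin 5) =>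
      ∑ A : Finset (Fin 5), (sgn A (symmDiff A C) * a A) •
        PiLp.proj 1 (fun _ : Finset (Fin 5) => V) (symmDiff A C)

/-- The action of `B ∈ 𝓑(V)` on `V₅`, coefficient by coefficient. -/
def lift (B : V →L[ℝ] V) : V5 V →L[ℝ] V5 V :=
  (PiLp.continuousLinearEquiv 1 ℝ (fun _ : Finset (Fin 5) => V)).symm.toContinuousLinearMap ∘L
    ContinuousLinearMap.pi fun C : Finset (Fin 5) =>
      B ∘L PiLp.proj 1 (fun _ : Finset (Fin 5) => V) C

/-- The product of `ℝ₅`. -/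
def Cl5.mul (a b : Cl5) : Cl5 := lmul a b

/-- The basis element `e_A` of `ℝ₅`. -/
def Cl5.e (A : Finset (Fin 5)) : Cl5 := PiLp.single 1 A (1 : ℝ)

lemma lmul_apply (a : Cl5) (v : V5 V) (C : Finset (Fin 5)) :
    lmul a v C = ∑ A, (sgn A (symmDiff A C) * a A) • v (symmDiff A C) := by
  simp [lmul]

lemma lift_apply (B : V →L[ℝ] V) (v : V5 V) (C : Finset (Fin 5)) : lift B v C = B (v C) := by
  simp [lift]

/-- `e_A e_B = ± e_{A ∆ B}`. -/
lemma Cl5.e_mul_e (A B : Finset (Fin 5)) :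
    Cl5.mul (Cl5.e A) (Cl5.e B) = sgn A B • Cl5.e (symmDiff A B) := by
  ext C
  have h : symmDiff A C = B ↔ C = symmDiff A B :=
    ⟨fun h => by rw [← h, symmDiff_symmDiff_cancel_left],
      fun h => by rw [h, symmDiff_symmDiff_cancel_left]⟩
  rw [Cl5.mul, lmul_apply, Finset.sum_eq_single A]
  · by_cases hC : C = symmDiff A B
    · subst hC; simp [Cl5.e, symmDiff_symmDiff_cancel_left]
    · have hB : symmDiff A C ≠ B := fun h' => hC (h.1 h')
      simp [Cl5.e, hC, hB]
  · intro D _ hD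
    simp [Cl5.e, hD]
  · simp

/-- `e_∅` is the unit. -/
lemma lmul_one : lmul (V := V) (Cl5.e ∅) = 1 := by
  ext v C
  rw [lmul_apply, Finset.sum_eq_single ∅]
  · have h : symmDiff ∅ C = C := bot_symmDiff C
    simp [Cl5.e, sgn, h]
  · intro D _ hD
    simp [Cl5.e, hD]
  · simp

/-- The defining relations `e_i e_j + e_j e_i = - 2 δ_{ij}` of the Clifford algebra. -/
lemma Cl5.e_relations (i j : Fin 5) :
    Cl5.mul (Cl5.e {i}) (Cl5.e {j}) + Cl5.mul (Cl5.e {j}) (Cl5.e {i}) =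
      (if i = j then (-2 : ℝ) else 0) • Cl5.e ∅ := by
  rw [Cl5.e_mul_e, Cl5.e_mul_e, symmDiff_comm ({j} : Finset (Fin 5)) {i}, ← add_smul]
  by_cases h : i = j
  · subst h
    simp [sgn]
    norm_num
  · rcases lt_or_gt_of_ne h with h' | h'
    · simp [sgn, h, h'.le, not_le.2 h']
    · simp [sgn, h, h'.le, not_le.2 h']

end Module

/-! ### Paravectors, slices and slice hyperholomorphic functions -/

/-- The space `ℝ⁶` of paravectors `x = x_0 + x_1 e_1 + ⋯ + x_5 e_5`. -/
abbrev Para := EuclideanSpace ℝ (Fin 6)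

/-- The paravector `x` as an element of `ℝ₅`. -/
def Para.toCl (x : Para) : Cl5 := x 0 • Cl5.e ∅ + ∑ j : Fin 5, x j.succ • Cl5.e {j}

/-- The sphere `𝕊` of purely imaginary paravectors of modulus one. -/
def unitSphere : Set Para := {x | x 0 = 0 ∧ ‖x‖ = 1}

/-- The point `u + J v` of `ℂ_J`, for `z = u + i v`. -/
def slicePt (J : Para) (z : ℂ) : Para := z.re • EuclideanSpace.single 0 (1 : ℝ) + z.im • J

/-- `U ∩ ℂ_J`, as a subset of `ℂ` through the identification `u + J v ↔ u + i v`. -/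
def slice (U : Set Para) (J : Para) : Set ℂ := {z | slicePt J z ∈ U}

/-- `u + I v ∈ U` implies `u + J v ∈ U` for all `J ∈ 𝕊`. -/
def IsAxiallySymmetric (U : Set Para) : Prop :=
  ∀ z : ℂ, ∀ I ∈ unitSphere, slicePt I z ∈ U → ∀ J ∈ unitSphere, slicePt J z ∈ U

/-- The set `{(u, v) : u + J v ∈ W for all J ∈ 𝕊}`. -/
def planeSet (W : Set Para) : Set (ℝ × ℝ) :=
  {p | ∀ J ∈ unitSphere, slicePt J ⟨p.1, p.2⟩ ∈ W}

/-- Differentiable `ℝ₅`-valued functions `α`, `β` on `planeSet W` with the even-odd conditions and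
the Cauchy-Riemann system. -/
structure IsCRPair (W : Set Para) (α β : ℝ × ℝ → Cl5) : Prop where
  diff_left : ∀ p ∈ planeSet W, DifferentiableAt ℝ α p
  diff_right : ∀ p ∈ planeSet W, DifferentiableAt ℝ β p
  even : ∀ u v : ℝ, (u, v) ∈ planeSet W → α (u, v) = α (u, -v)
  odd : ∀ u v : ℝ, (u, v) ∈ planeSet W → β (u, v) = -β (u, -v)
  cr_one : ∀ p ∈ planeSet W, fderiv ℝ α p (1, 0) - fderiv ℝ β p (0, 1) = 0
  cr_two : ∀ p ∈ planeSet W, fderiv ℝ α p (0, 1) + fderiv ℝ β p (1, 0) = 0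

/-- `f` is left slice hyperholomorphic on the axially symmetric open set `W`:
`f (u + J v) = α (u, v) + J β (u, v)`. -/
def IsLeftSliceHyperholomorphic (W : Set Para) (f : Para → Cl5) : Prop :=
  IsOpen W ∧ IsAxiallySymmetric W ∧ ∃ α β : ℝ × ℝ → Cl5, IsCRPair W α β ∧
    ∀ u v : ℝ, (u, v) ∈ planeSet W → ∀ J ∈ unitSphere,
      f (slicePt J ⟨u, v⟩) = α (u, v) + Cl5.mul J.toCl (β (u, v))

/-- `f` is right slice hyperholomorphic on the axially symmetric open set `W`:
`f (u + J v) = α (u, v) + β (u, v) J`. -/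
def IsRightSliceHyperholomorphic (W : Set Para) (f : Para → Cl5) : Prop :=
  IsOpen W ∧ IsAxiallySymmetric W ∧ ∃ α β : ℝ × ℝ → Cl5, IsCRPair W α β ∧
    ∀ u v : ℝ, (u, v) ∈ planeSet W → ∀ J ∈ unitSphere,
      f (slicePt J ⟨u, v⟩) = α (u, v) + Cl5.mul (β (u, v)) J.toCl

/-! ### Slice Cauchy domains -/

/-- `γ`, restricted to `[0, 1]`, is a piecewise continuously differentiable Jordan curve. -/
structure IsPiecewiseC1Jordan (γ : ℝ → ℂ) : Prop where
  pieces : ∃ (m : ℕ) (t : ℕ → ℝ), Monotone t ∧ t 0 = 0 ∧ t m = 1 ∧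
    ∀ k < m, ContDiffOn ℝ 1 γ (Set.Icc (t k) (t (k + 1)))
  closed : γ 0 = γ 1
  simple : Set.InjOn γ (Set.Ico 0 1)

/-- The boundary of `Ω` is the union of the pairwise disjoint piecewise continuously differentiable
Jordan curves `γ 0, …, γ (n - 1)`. -/
structure IsJordanBoundary {n : ℕ} (γ : Fin n → ℝ → ℂ) (Ω : Set ℂ) : Prop where
  jordan : ∀ i, IsPiecewiseC1Jordan (γ i)
  disj : ∀ i j, i ≠ j → Disjoint (γ i '' Set.Icc 0 1) (γ j '' Set.Icc 0 1)
  union : ⋃ i, γ i '' Set.Icc 0 1 = frontier Ω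

/-- The winding number of the system of closed curves `γ` around `z`. -/
def windingNumber {n : ℕ} (γ : Fin n → ℝ → ℂ) (z : ℂ) : ℂ :=
  (2 * Real.pi * Complex.I)⁻¹ * ∑ i, ∫ t in (0 : ℝ)..1, deriv (γ i) t / (γ i t - z)

/-- The curves `γ 0, …, γ (n - 1)` form the positively oriented boundary of `Ω`: they make up the
boundary, and together they wind once around the points of `Ω` and not around the points outside
the closure of `Ω`. -/
structure IsPositiveBoundary {n : ℕ} (γ : Fin n → ℝ → ℂ) (Ω : Set ℂ) : Prop where
  boundary : IsJordanBoundary γ Ω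
  inside : ∀ z ∈ Ω, windingNumber γ z = 1
  outside : ∀ z ∉ closure Ω, windingNumber γ z = 0

/-- `U` is a slice Cauchy domain. -/
def IsSliceCauchyDomain (U : Set Para) : Prop :=
  IsOpen U ∧ IsAxiallySymmetric U ∧
    ∀ J ∈ unitSphere, ∃ (n : ℕ) (γ : Fin n → ℝ → ℂ), IsJordanBoundary γ (slice U J)

/-! ### Operators -/

section Operators

variable {V : Type*} [NormedAddCommGroup V] [NormedSpace ℝ V]

/-- `𝓑(V₅)`: the operators `∑_A T_A e_A` with `T_A ∈ 𝓑(V)`. -/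
def boundedOps (V : Type*) [NormedAddCommGroup V] [NormedSpace ℝ V] : Set (V5 V →L[ℝ] V5 V) :=
  {R | ∃ t : Finset (Fin 5) → (V →L[ℝ] V), R = ∑ A, lift (t A) * lmul (Cl5.e A)}

/-- The paravector `s` as the operator `s 𝓘`, `v ↦ s v`. -/
def scal (V : Type*) [NormedAddCommGroup V] [NormedSpace ℝ V] (s : Para) : V5 V →L[ℝ] V5 V :=
  lmul s.toCl

/-- The operator `T = T_0 + e_1 T_1 + ⋯ + e_5 T_5`. -/
def opT (T : Fin 6 → (V →L[ℝ] V)) : V5 V →L[ℝ] V5 V :=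
  lift (T 0) + ∑ j : Fin 5, lmul (Cl5.e {j}) * lift (T j.succ)

/-- The components `(T_0, -T_1, …, -T_5)` of the conjugate of `T`. -/
def conjT (T : Fin 6 → (V →L[ℝ] V)) : Fin 6 → (V →L[ℝ] V) :=
  fun i => if i = 0 then T 0 else -T i

/-- `𝓠_{c,s}(T) = s² 𝓘 - s (T + T̄) + T T̄`. -/
def Qc (s : Para) (T : Fin 6 → (V →L[ℝ] V)) : V5 V →L[ℝ] V5 V :=
  scal V s ^ 2 - scal V s * (opT T + opT (conjT T)) + opT T * opT (conjT T)

/-- The `S`-spectrum: the `s ∈ ℝ⁶` for which `𝓠_{c,s}(T)` is not invertible in `𝓑(V₅)`. -/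
def sSpectrum (T : Fin 6 → (V →L[ℝ] V)) : Set Para :=
  {s | ¬ ∃ R ∈ boundedOps V, Qc s T * R = 1 ∧ R * Qc s T = 1}

/-- `𝓠_{c,s}(T)⁻¹`; it is the inverse of `𝓠_{c,s}(T)` for `s` outside the `S`-spectrum. -/
def QcInv (s : Para) (T : Fin 6 → (V →L[ℝ] V)) : V5 V →L[ℝ] V5 V :=
  Ring.inverse (Qc s T)

/-- The left `SC`-resolvent operator. -/
def SL (s : Para) (T : Fin 6 → (V →L[ℝ] V)) : V5 V →L[ℝ] V5 V :=
  (scal V s - opT (conjT T)) * QcInv s T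

/-- The right `SC`-resolvent operator. -/
def SR (s : Para) (T : Fin 6 → (V →L[ℝ] V)) : V5 V →L[ℝ] V5 V :=
  QcInv s T * (scal V s - opT (conjT T))

/-- Labels for the operators `𝓓`, `Δ`, `Δ𝓓`, `𝓓̄`, `𝓓̄²`, `𝓓²`, `Δ𝓓̄` of the fine structure. -/
inductive FineOp
  | D
  | Lap
  | LapD
  | Dbar
  | DbarSq
  | DSq
  | LapDbar

/-- The left resolvent operators of the fine structure. -/
def resolventL (P : FineOp) (s : Para) (T : Fin 6 → (V →L[ℝ] V)) : V5 V →L[ℝ] V5 V :=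
  match P with
  | .D => (-4 : ℝ) • QcInv s T
  | .Lap => (-8 : ℝ) • (SL s T * QcInv s T)
  | .LapD => (16 : ℝ) • QcInv s T ^ 2
  | .Dbar =>
      (4 : ℝ) • ((scal V s - opT (conjT T)) * QcInv s T ^ 2 * (scal V s - lift (T 0)))
        + (2 : ℝ) • QcInv s T
  | .DbarSq =>
      (32 : ℝ) • ((scal V s - opT (conjT T)) * QcInv s T ^ 3 * (scal V s - lift (T 0)) ^ 2)
  | .DSq => (8 : ℝ) • (SL s (conjT T) * QcInv s T)
  | .LapDbar =>
      (-64 : ℝ) • ((scal V s - opT (conjT T)) * QcInv s T ^ 3 * (scal V s - lift (T 0)))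

/-- The right resolvent operators of the fine structure. -/
def resolventR (P : FineOp) (s : Para) (T : Fin 6 → (V →L[ℝ] V)) : V5 V →L[ℝ] V5 V :=
  match P with
  | .D => (-4 : ℝ) • QcInv s T
  | .Lap => (-8 : ℝ) • (QcInv s T * SR s T)
  | .LapD => (16 : ℝ) • QcInv s T ^ 2
  | .Dbar =>
      (4 : ℝ) • ((scal V s - lift (T 0)) * QcInv s T ^ 2 * (scal V s - opT (conjT T)))
        + (2 : ℝ) • QcInv s T
  | .DbarSq =>
      (32 : ℝ) • ((scal V s - lift (T 0)) ^ 2 * QcInv s T ^ 3 * (scal V s - opT (conjT T)))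
  | .DSq => (8 : ℝ) • (QcInv s T * SR s (conjT T))
  | .LapDbar =>
      (-64 : ℝ) • ((scal V s - lift (T 0)) * QcInv s T ^ 3 * (scal V s - opT (conjT T)))

/-! ### The functional calculi -/

/-- `S⁻¹_{P,L}(s,T) ds_J f(s)` along the curve `s = γ(t)` in `ℂ_J`, where `ds_J = ds (-J)`. -/
def integrandL (P : FineOp) (T : Fin 6 → (V →L[ℝ] V)) (f : Para → Cl5) (J : Para) (γ : ℝ → ℂ)
    (t : ℝ) : V5 V →L[ℝ] V5 V :=
  resolventL P (slicePt J (γ t)) T *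
    (scal V (slicePt J (deriv γ t)) * scal V (-J)) * lmul (f (slicePt J (γ t)))

/-- `f(s) ds_J S⁻¹_{P,R}(s,T)` along the curve `s = γ(t)` in `ℂ_J`, where `ds_J = ds (-J)`. -/
def integrandR (P : FineOp) (T : Fin 6 → (V →L[ℝ] V)) (f : Para → Cl5) (J : Para) (γ : ℝ → ℂ)
    (t : ℝ) : V5 V →L[ℝ] V5 V :=
  lmul (f (slicePt J (γ t))) * (scal V (slicePt J (deriv γ t)) * scal V (-J)) *
    resolventR P (slicePt J (γ t)) T

/-- `(1 / 2π) ∫ S⁻¹_{P,L}(s,T) ds_J f(s)` over the system of curves `γ` in `ℂ_J`. -/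
def calcL (P : FineOp) (T : Fin 6 → (V →L[ℝ] V)) (f : Para → Cl5) (J : Para) {n : ℕ}
    (γ : Fin n → ℝ → ℂ) : V5 V →L[ℝ] V5 V :=
  (1 / (2 * Real.pi)) • ∑ i, ∫ t in (0 : ℝ)..1, integrandL P T f J (γ i) t

/-- `(1 / 2π) ∫ f(s) ds_J S⁻¹_{P,R}(s,T)` over the system of curves `γ` in `ℂ_J`. -/
def calcR (P : FineOp) (T : Fin 6 → (V →L[ℝ] V)) (f : Para → Cl5) (J : Para) {n : ℕ}
    (γ : Fin n → ℝ → ℂ) : V5 V →L[ℝ] V5 V :=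
  (1 / (2 * Real.pi)) • ∑ i, ∫ t in (0 : ℝ)..1, integrandR P T f J (γ i) t

/-- The data that enter the integrals for `T` and a function with domain `W`: a bounded slice Cauchy
domain `U` with `σ_S(T) ⊆ U` and `closure U ⊆ W`, an imaginary unit `J`, and a parametrization `γ`
of the positively oriented boundary of `U ∩ ℂ_J`. -/
structure IsAdmissible (T : Fin 6 → (V →L[ℝ] V)) (W U : Set Para) (J : Para) {n : ℕ}
    (γ : Fin n → ℝ → ℂ) : Prop where
  bounded : Bornology.IsBounded U
  cauchy : IsSliceCauchyDomain U
  spectrum_subset : sSpectrum T ⊆ U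
  closure_subset : closure U ⊆ W
  unit : J ∈ unitSphere
  positive : IsPositiveBoundary γ (slice U J)

end Operators

end FineStructure

end

open FineStructure

/-! Everything takes place in the real Banach algebra 𝓑 of continuous operators on V₅, where J ∈ 𝕊
acts as an element j with j² = -1. Since T + T̄ = 2T_0 and T T̄ = T_0² + ⋯ + T_5², the operator
𝓠_s(T) is a quadratic polynomial in s whose coefficients commute with every j. Its inverse at s = u
+ Jv is therefore p(z) + q(z) j with z = u + iv, where p and q do not depend on J, commute with all
units and make p + iq holomorphic (`isIntrinsicOn_inverse_quad`). Invertibility at one point of a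
sphere gives it on the whole sphere, because a vector orthogonal to J conjugates j into -j
(`isUnit_quadNorm`). In the left resolvents T̄ or T, which need not commute with the units, occurs
only in the leftmost factor. So each left resolvent is A + B j with A + iB holomorphic, while a left
slice hyperholomorphic f is C + j D. The right case is the mirror image.

The integrand is thus (A + B j) ds (-j) (C + j D). With H_c = (A + iB) c (C + iD), which is
holomorphic off the spectrum for every c ∈ 𝓑, it equals Im(H_1 dz) - Re(H_j dz)
(`stem_mul_stem_eq`). The first term does not involve J, and its integral is independent of the
contour by Cauchy's theorem. As A, C are even and B, D odd in v, H_j takes conjugate values at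
conjugate points; the domain is symmetric in the real axis, so ∮ H_j dz is purely imaginary and the
second term integrates to zero. This is `sum_integral_stemIntegrand_eq`; real functionals on 𝓑
reduce it to scalar functions.

Only winding numbers are known of the contours, so Cauchy's theorem is needed in its homological
form `sum_integral_eq_zero`, which follows from Dixon's argument. It is applied to γ - γ' for the
independence of the contour and to γ together with its mirror image for the symmetry. -/

section Development

open MeasureTheory Set Metric Filter Topology ComplexConjugate

/-! ### Cauchy's theorem for cycles with vanishing Cauchy transform -/

/-- Differentiation under the integral sign. A bound on the kernel alone suffices, because Cauchy's
estimate turns it into a bound on the derivative in z over a smaller ball. -/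
lemma differentiableAt_integral_kernel {k : ℂ → ℝ → ℂ} {g : ℝ → ℂ} {z₀ : ℂ} {r M : ℝ} (hr : 0 < r)
    (hg : IntervalIntegrable g volume 0 1)
    (hk : ∀ z ∈ ball z₀ r, ContinuousOn (k z) (Icc 0 1))
    (hd : ∀ t ∈ Icc (0 : ℝ) 1, DifferentiableOn ℂ (fun z => k z t) (ball z₀ r))
    (hM : ∀ z ∈ ball z₀ r, ∀ t ∈ Icc (0 : ℝ) 1, ‖k z t‖ ≤ M) :
    DifferentiableAt ℂ (fun z => ∫ t in (0 : ℝ)..1, k z t * g t) z₀ := by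
  have hmem : ∀ {t : ℝ}, t ∈ uIoc (0 : ℝ) 1 → t ∈ Icc (0 : ℝ) 1 := fun {t} ht => by
    rw [uIoc_of_le zero_le_one] at ht; exact Ioc_subset_Icc_self ht
  have hgm : AEStronglyMeasurable g (volume.restrict (uIoc 0 1)) := by
    rw [uIoc_of_le zero_le_one]; exact hg.aestronglyMeasurable
  have hkm : ∀ z ∈ ball z₀ r, AEStronglyMeasurable (k z) (volume.restrict (uIoc 0 1)) := by
    intro z hz
    exact ((hk z hz).mono fun t ht => hmem ht).aestronglyMeasurable measurableSet_uIoc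
  have hz₀ : z₀ ∈ ball z₀ r := mem_ball_self hr
  have hda : ∀ t ∈ uIoc (0 : ℝ) 1, ∀ z ∈ ball z₀ (r / 2),
      HasDerivAt (fun z => k z t) (deriv (fun z => k z t) z) z := by
    intro t ht z hz
    exact ((hd t (hmem ht)).differentiableAt
      (isOpen_ball.mem_nhds (ball_subset_ball (by linarith) hz))).hasDerivAt
  have hF' : AEStronglyMeasurable (fun t => deriv (fun z => k z t) z₀)
      (volume.restrict (uIoc 0 1)) := by
    classical
    -- The derivative in z is a limit of difference quotients, which are measurable in t. Outside
    -- the ball nothing is known of the kernel, so the quotient is replaced by 0 there.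
    refine aestronglyMeasurable_of_tendsto_ae (𝓝[≠] z₀)
      (f := fun z t => if z ∈ ball z₀ r then slope (fun z => k z t) z₀ z else 0) ?_ ?_
    · intro z
      by_cases hz : z ∈ ball z₀ r
      · simp only [hz, if_true, slope_def_field]
        simp only [div_eq_mul_inv]
        exact ((hkm z hz).sub (hkm z₀ hz₀)).mul aestronglyMeasurable_const
      · simp only [hz, if_false]
        exact aestronglyMeasurable_const
    · filter_upwards [ae_restrict_mem measurableSet_uIoc] with t ht
      have := (hda t ht z₀ (mem_ball_self (by positivity))).tendsto_slope
      refine this.congr' ?_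
      filter_upwards [nhdsWithin_le_nhds (ball_mem_nhds z₀ hr)] with z hz
      simp only [hz, if_true]
  refine (intervalIntegral.hasDerivAt_integral_of_dominated_loc_of_deriv_le (𝕜 := ℂ)
    (F := fun z t => k z t * g t) (F' := fun z t => deriv (fun z => k z t) z * g t)
    (bound := fun t => M / (r / 4) * ‖g t‖) (s := ball z₀ (r / 2))
    (ball_mem_nhds z₀ (by positivity)) ?_ ?_ ?_ ?_ ?_ ?_).2.differentiableAt
  · filter_upwards [ball_mem_nhds z₀ hr] with z hz
    exact (hkm z hz).mul hgm
  · exact hg.continuousOn_mul (by simpa [uIcc_of_le] using hk z₀ hz₀)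
  · exact hF'.mul hgm
  · filter_upwards with t ht z hz
    rw [norm_mul]
    refine mul_le_mul_of_nonneg_right ?_ (norm_nonneg _)
    -- Circles of radius r / 4 about points of the half ball stay in the ball of radius r; Cauchy's
    -- estimate on them gives M / (r / 4).
    have hsub : closedBall z (r / 4) ⊆ ball z₀ r := by
      intro w hw
      rw [mem_ball] at hz ⊢; rw [mem_closedBall] at hw
      linarith [dist_triangle w z z₀]
    refine Complex.norm_deriv_le_of_forall_mem_sphere_norm_le (by positivity) ?_ ?_
    · exact ((hd t (hmem ht)).mono hsub).diffContOnCl_ball subset_rfl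
    · exact fun w hw => hM w (hsub (sphere_subset_closedBall hw)) t (hmem ht)
  · exact hg.norm.const_mul _
  · filter_upwards with t ht z hz
    exact (hda t ht z hz).mul_const _

/-- The divided difference `(F w - F z) / (w - z)` is bounded for `z` near a given point and `w` in
a compact set. -/
lemma exists_ball_norm_dslope_le {F : ℂ → ℂ} {Ω K : Set ℂ} (hΩ : IsOpen Ω)
    (hF : DifferentiableOn ℂ F Ω) (hK : IsCompact K) (hKΩ : K ⊆ Ω) {z₀ : ℂ} (hz₀ : z₀ ∈ Ω) :
    ∃ r > 0, ∃ M, ball z₀ r ⊆ Ω ∧ ∀ z ∈ ball z₀ r, ∀ w ∈ K, ‖dslope F w z‖ ≤ M := by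
  obtain ⟨r, hr, hrΩ⟩ := nhds_basis_closedBall.mem_iff.1 (hΩ.mem_nhds hz₀)
  have hdF : ContinuousOn (deriv F) Ω := (hF.deriv hΩ).continuousOn
  obtain ⟨C₁, hC₁⟩ := (isCompact_closedBall z₀ r).exists_bound_of_continuousOn (hdF.mono hrΩ)
  obtain ⟨C₂, hC₂⟩ := (isCompact_closedBall z₀ r).exists_bound_of_continuousOn
    (hF.continuousOn.mono hrΩ)
  obtain ⟨C₃, hC₃⟩ := hK.exists_bound_of_continuousOn (hF.continuousOn.mono hKΩ)
  refine ⟨r / 2, by positivity, max C₁ ((C₂ + C₃) / (r / 2)),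
    (ball_subset_ball (by linarith)).trans (ball_subset_closedBall.trans hrΩ), ?_⟩
  intro z hz w hw
  have hz' : z ∈ closedBall z₀ r := ball_subset_closedBall (ball_subset_ball (by linarith) hz)
  by_cases hwz : z = w
  · subst hwz
    rw [dslope_same]
    exact (hC₁ z hz').trans (le_max_left _ _)
  have hpos : 0 < ‖z - w‖ := norm_pos_iff.2 (sub_ne_zero.2 hwz)
  rw [dslope_of_ne _ hwz, slope_def_field, norm_div]
  -- For w in the ball, the mean value inequality applies by convexity. Otherwise |w - z| is at
  -- least r / 2 and bounds for F itself are enough.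
  by_cases hwb : w ∈ closedBall z₀ r
  · refine le_trans ?_ (le_max_left _ _)
    rw [div_le_iff₀ hpos]
    refine (convex_closedBall z₀ r).norm_image_sub_le_of_norm_deriv_le (fun x hx => ?_) hC₁ hwb hz'
    exact hF.differentiableAt (hΩ.mem_nhds (hrΩ hx))
  · refine le_trans ?_ (le_max_right _ _)
    have hd : r / 2 ≤ ‖z - w‖ := by
      rw [mem_closedBall, not_le] at hwb
      rw [mem_ball] at hz
      rw [← dist_eq_norm]
      linarith [dist_triangle w z z₀, dist_comm z w]
    have h0 : 0 ≤ C₂ + C₃ :=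
      add_nonneg ((norm_nonneg _).trans (hC₂ z hz')) ((norm_nonneg _).trans (hC₃ w hw))
    refine (div_le_div_of_nonneg_right ((norm_sub_le _ _).trans
      (add_le_add (hC₂ z hz') (hC₃ w hw))) hpos.le).trans ?_
    exact div_le_div_of_nonneg_left h0 (by positivity) hd

section Cycle

variable {ι : Type*} [Fintype ι] {γ g : ι → ℝ → ℂ} {Ω Ω' : Set ℂ} {F : ℂ → ℂ}

/-- Cauchy's integral formula outside the domain, for a family of weighted curves whose Cauchy
transform vanishes on an open set that covers the complement of the domain. -/
lemma sum_integral_div_eq_zero (hΩ : IsOpen Ω) (hΩ' : IsOpen Ω') (hcover : Ω ∪ Ω' = univ)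
    (hbdd : Bornology.IsBounded Ω'ᶜ) (hγ : ∀ i, ContinuousOn (γ i) (Icc 0 1))
    (hg : ∀ i, IntervalIntegrable (g i) volume 0 1)
    (hγΩ : ∀ i, ∀ t ∈ Icc (0 : ℝ) 1, γ i t ∈ Ω) (hγΩ' : ∀ i, ∀ t ∈ Icc (0 : ℝ) 1, γ i t ∉ Ω')
    (hwind : ∀ z ∈ Ω', ∑ i, ∫ t in (0 : ℝ)..1, g i t / (γ i t - z) = 0)
    (hF : DifferentiableOn ℂ F Ω) {z : ℂ} (hz : z ∈ Ω') :
    ∑ i, ∫ t in (0 : ℝ)..1, F (γ i t) / (γ i t - z) * g i t = 0 := by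
  classical
  have hIcc : uIcc (0 : ℝ) 1 = Icc 0 1 := uIcc_of_le zero_le_one
  have hK : ∀ i, IsCompact (γ i '' Icc 0 1) := fun i => isCompact_Icc.image_of_continuousOn (hγ i)
  have hFγ : ∀ i, ContinuousOn (fun t => F (γ i t)) (Icc 0 1) := fun i =>
    hF.continuousOn.comp (hγ i) (hγΩ i)
  have hne : ∀ i, ∀ t ∈ Icc (0 : ℝ) 1, ∀ z ∈ Ω', γ i t - z ≠ 0 := fun i t ht z hz h =>
    hγΩ' i t ht (by rwa [sub_eq_zero.1 h])
  have hcont : ∀ i, ∀ z ∈ Ω', ContinuousOn (fun t => (γ i t - z)⁻¹) (Icc 0 1) := fun i z hz =>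
    ((hγ i).sub continuousOn_const).inv₀ fun t ht => hne i t ht z hz
  -- Dixon's argument: h₁ is holomorphic on Ω, h₂ on Ω', and they agree on Ω' because the Cauchy
  -- transform vanishes there. So h₁ is entire, and it tends to 0 at infinity like h₂; by Liouville
  -- it is 0.
  let h₁ : ℂ → ℂ := fun z => ∑ i, ∫ t in (0 : ℝ)..1, dslope F (γ i t) z * g i t
  let h₂ : ℂ → ℂ := fun z => ∑ i, ∫ t in (0 : ℝ)..1, F (γ i t) / (γ i t - z) * g i t
  have hagree : ∀ z ∈ Ω', h₁ z = h₂ z := by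
    intro z hz
    have hsum : h₂ z - h₁ z = F z * ∑ i, ∫ t in (0 : ℝ)..1, g i t / (γ i t - z) := by
      simp only [h₁, h₂]
      rw [← Finset.sum_sub_distrib, Finset.mul_sum]
      refine Finset.sum_congr rfl fun i _ => ?_
      have hslope : ∀ t ∈ Icc (0 : ℝ) 1,
          dslope F (γ i t) z = (F (γ i t) - F z) * (γ i t - z)⁻¹ := by
        intro t ht
        have h := hne i t ht z hz
        have h' : z - γ i t ≠ 0 := by rw [← neg_sub]; exact neg_ne_zero.2 h
        rw [dslope_of_ne _ (sub_ne_zero.1 h'), slope_def_field]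
        field_simp
        ring
      rw [← intervalIntegral.integral_const_mul, ← intervalIntegral.integral_sub]
      · refine intervalIntegral.integral_congr fun t ht => ?_
        rw [hIcc] at ht
        simp only [hslope t ht]
        ring
      · refine (hg i).continuousOn_mul ?_
        rw [hIcc]
        simpa only [div_eq_mul_inv] using (hFγ i).fun_mul (hcont i z hz)
      · refine (hg i).continuousOn_mul ?_
        rw [hIcc]
        exact (((hFγ i).sub continuousOn_const).mul (hcont i z hz)).congr hslope
    rw [hwind z hz, mul_zero] at hsum
    exact (sub_eq_zero.1 hsum).symm
  have hd₁ : ∀ z ∈ Ω, DifferentiableAt ℂ h₁ z := by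
    intro z hz
    refine DifferentiableAt.fun_sum fun i _ => ?_
    obtain ⟨r, hr, M, hrΩ, hM⟩ := exists_ball_norm_dslope_le hΩ hF (hK i)
      (image_subset_iff.2 (hγΩ i)) hz
    refine differentiableAt_integral_kernel hr (hg i) ?_ ?_
      (fun w hw t ht => hM w hw _ (mem_image_of_mem _ ht))
    · intro w hw
      have hw' : Ω ∈ 𝓝 w := hΩ.mem_nhds (hrΩ hw)
      -- The divided difference is symmetric in its two points, so continuity along the curve is
      -- that of `dslope F w`.
      have hc : ContinuousOn (dslope F w) Ω :=
        ((Complex.differentiableOn_dslope hw').2 hF).continuousOn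
      refine (hc.comp (hγ i) (hγΩ i)).congr fun t _ => ?_
      by_cases hwt : w = γ i t
      · simp [← hwt]
      · simp only [Function.comp]
        rw [dslope_of_ne _ hwt, dslope_of_ne _ (Ne.symm hwt), slope_comm]
    · intro t ht
      exact ((Complex.differentiableOn_dslope (hΩ.mem_nhds (hγΩ i t ht))).2 hF).mono hrΩ
  have hd₂ : ∀ z ∈ Ω', DifferentiableAt ℂ h₂ z := by
    intro z hz
    refine DifferentiableAt.fun_sum fun i _ => ?_
    obtain ⟨r, hr, hrΩ⟩ := nhds_basis_closedBall.mem_iff.1 (hΩ'.mem_nhds hz)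
    obtain ⟨C, hC⟩ := isCompact_Icc.exists_bound_of_continuousOn (hFγ i)
    have hhalf : ball z (r / 2) ⊆ Ω' :=
      (ball_subset_ball (by linarith)).trans (ball_subset_closedBall.trans hrΩ)
    refine differentiableAt_integral_kernel (M := C / (r / 2)) (half_pos hr) (hg i) ?_ ?_ ?_
    · intro w hw
      simpa only [div_eq_mul_inv] using (hFγ i).fun_mul (hcont i w (hhalf hw))
    · intro t ht
      refine (differentiableOn_const _).div
        ((differentiableOn_const _).sub differentiableOn_id) fun w hw => hne i t ht w (hhalf hw)
    · intro w hw t ht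
      rw [norm_div]
      have hd : r / 2 ≤ ‖γ i t - w‖ := by
        have h1 : γ i t ∉ closedBall z r := fun h => hγΩ' i t ht (hrΩ h)
        rw [mem_closedBall, not_le] at h1
        rw [mem_ball] at hw
        rw [← dist_eq_norm]
        linarith [dist_triangle (γ i t) w z]
      refine (div_le_div_of_nonneg_right (hC t ht) (norm_nonneg _)).trans ?_
      exact div_le_div_of_nonneg_left ((norm_nonneg _).trans (hC t ht)) (by positivity) hd
  have hdiff : Differentiable ℂ h₁ := by
    intro z
    rcases (hcover ▸ mem_univ z : z ∈ Ω ∪ Ω') with hz | hz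
    · exact hd₁ z hz
    · refine (hd₂ z hz).congr_of_eventuallyEq ?_
      filter_upwards [hΩ'.mem_nhds hz] with w hw using hagree w hw
  have hlim : Tendsto h₁ (cocompact ℂ) (𝓝 0) := by
    have hev : ∀ᶠ z in cocompact ℂ, z ∈ Ω' := by
      rw [← Metric.cobounded_eq_cocompact]
      exact Bornology.isBounded_compl_iff.1 hbdd
    have hlim₂ : Tendsto h₂ (cocompact ℂ) (𝓝 0) := by
      rw [show (0 : ℂ) = ∑ _i : ι, 0 by simp]
      refine tendsto_finsetSum _ fun i _ => ?_
      obtain ⟨C, hC⟩ := isCompact_Icc.exists_bound_of_continuousOn (hFγ i)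
      obtain ⟨ρ, hρ⟩ := isCompact_Icc.exists_bound_of_continuousOn (hγ i)
      have hC0 : 0 ≤ C := (norm_nonneg _).trans (hC 0 (by simp))
      set N : ℝ := ∫ t in (0 : ℝ)..1, ‖g i t‖ with hN
      have hlimb : Tendsto (fun z : ℂ => C / (‖z‖ - ρ) * N) (cocompact ℂ) (𝓝 0) := by
        rw [show (0 : ℝ) = 0 * N by simp]
        refine Tendsto.mul_const _ (tendsto_const_nhds.div_atTop ?_)
        exact tendsto_atTop_add_const_right _ _ (tendsto_norm_cocompact_atTop (E := ℂ))
      refine squeeze_zero_norm' ?_ hlimb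
      filter_upwards [(tendsto_norm_cocompact_atTop (E := ℂ)).eventually_gt_atTop ρ] with z hz
      rw [hN, ← intervalIntegral.integral_const_mul]
      refine intervalIntegral.norm_integral_le_of_norm_le zero_le_one ?_ ((hg i).norm.const_mul _)
      filter_upwards with t ht
      have ht' := Ioc_subset_Icc_self ht
      rw [norm_mul, norm_div]
      refine mul_le_mul_of_nonneg_right ?_ (norm_nonneg _)
      have h1 : ‖z‖ - ρ ≤ ‖γ i t - z‖ := by
        have := norm_sub_norm_le z (γ i t)
        rw [norm_sub_rev] at this
        linarith [hρ t ht']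
      refine (div_le_div_of_nonneg_right (hC t ht') (norm_nonneg _)).trans ?_
      exact div_le_div_of_nonneg_left hC0 (by linarith) h1
    refine hlim₂.congr' ?_
    filter_upwards [hev] with z hz using (hagree z hz).symm
  have := hdiff.apply_eq_of_tendsto_cocompact z hlim
  rwa [hagree z hz] at this

/-- **Cauchy's theorem** for a family of weighted curves whose Cauchy transform vanishes on an open
set that covers the complement of the domain. -/
theorem sum_integral_eq_zero (hΩ : IsOpen Ω) (hΩ' : IsOpen Ω') (hcover : Ω ∪ Ω' = univ)
    (hbdd : Bornology.IsBounded Ω'ᶜ) (hγ : ∀ i, ContinuousOn (γ i) (Icc 0 1))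
    (hg : ∀ i, IntervalIntegrable (g i) volume 0 1)
    (hγΩ : ∀ i, ∀ t ∈ Icc (0 : ℝ) 1, γ i t ∈ Ω) (hγΩ' : ∀ i, ∀ t ∈ Icc (0 : ℝ) 1, γ i t ∉ Ω')
    (hwind : ∀ z ∈ Ω', ∑ i, ∫ t in (0 : ℝ)..1, g i t / (γ i t - z) = 0)
    (hF : DifferentiableOn ℂ F Ω) :
    ∑ i, ∫ t in (0 : ℝ)..1, F (γ i t) * g i t = 0 := by
  obtain ⟨z, hz⟩ : Ω'.Nonempty := by
    by_contra hempty
    rw [not_nonempty_iff_eq_empty] at hempty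
    rw [hempty, compl_empty] at hbdd
    exact NormedSpace.unbounded_univ ℂ ℂ hbdd
  -- The factor w - z, for a point z of Ω', cancels the denominator in the integral formula.
  have hG : DifferentiableOn ℂ (fun w => (w - z) * F w) Ω :=
    (differentiableOn_id.sub (differentiableOn_const _)).mul hF
  rw [← sum_integral_div_eq_zero hΩ hΩ' hcover hbdd hγ hg hγΩ hγΩ' hwind hG hz]
  refine Finset.sum_congr rfl fun i _ => intervalIntegral.integral_congr fun t ht => ?_
  rw [uIcc_of_le zero_le_one] at ht
  have hne : γ i t - z ≠ 0 := fun h => hγΩ' i t ht (by rwa [sub_eq_zero.1 h])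
  field_simp

end Cycle

/-! ### Inverses in a monoid with zero -/

lemma Commute.ringInverse_left' {R : Type*} [MonoidWithZero R] {a c : R} (h : Commute a c) :
    Commute (Ring.inverse a) c := by
  by_cases ha : IsUnit a
  · obtain ⟨u, rfl⟩ := ha
    rw [Ring.inverse_unit]
    exact h.units_inv_left
  · rw [Ring.inverse_non_unit _ ha]
    exact Commute.zero_left c

lemma Ring.inverse_eq_of_mul_eq_one {R : Type*} [MonoidWithZero R] {a b : R} (hab : a * b = 1)
    (hba : b * a = 1) :
    Ring.inverse a = b :=
  Ring.inverse_unit (⟨a, b, hab, hba⟩ : Rˣ)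

/-! ### Holomorphic pairs with values in a real Banach algebra -/

section HolPair

variable {𝓑 : Type*} [NormedRing 𝓑] [NormedAlgebra ℝ 𝓑]

/-- The formal sum `A + i B` of the `𝓑`-valued functions `A`, `B` is complex differentiable
at `z`. -/
def HolPairAt (A B : ℂ → 𝓑) (z : ℂ) : Prop :=
  ∃ (a b : 𝓑) (A' B' : ℂ →L[ℝ] 𝓑), HasFDerivAt A A' z ∧ HasFDerivAt B B' z ∧
    (∀ h, A' h = h.re • a - h.im • b) ∧ ∀ h, B' h = h.re • b + h.im • a

namespace HolPairAt

variable {A B C D : ℂ → 𝓑} {z : ℂ}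

lemma differentiableAt_left (h : HolPairAt A B z) : DifferentiableAt ℝ A z := by
  obtain ⟨a, b, A', B', hA, hB, _⟩ := h
  exact hA.differentiableAt

lemma differentiableAt_right (h : HolPairAt A B z) : DifferentiableAt ℝ B z := by
  obtain ⟨a, b, A', B', hA, hB, _⟩ := h
  exact hB.differentiableAt

lemma const (c : 𝓑) (z : ℂ) : HolPairAt (fun _ => c) (fun _ => 0) z :=
  ⟨0, 0, 0, 0, hasFDerivAt_const _ _, hasFDerivAt_const _ _, by simp, by simp⟩

lemma id (z : ℂ) : HolPairAt (fun z : ℂ => z.re • (1 : 𝓑)) (fun z => z.im • (1 : 𝓑)) z :=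
  ⟨1, 0, Complex.reCLM.smulRight 1, Complex.imCLM.smulRight 1,
    (Complex.reCLM.smulRight (1 : 𝓑)).hasFDerivAt, (Complex.imCLM.smulRight (1 : 𝓑)).hasFDerivAt,
    by simp, by simp⟩

lemma add (h : HolPairAt A B z) (h' : HolPairAt C D z) :
    HolPairAt (fun z => A z + C z) (fun z => B z + D z) z := by
  obtain ⟨a, b, A', B', hA, hB, hA', hB'⟩ := h
  obtain ⟨c, d, C', D', hC, hD, hC', hD'⟩ := h'
  refine ⟨a + c, b + d, A' + C', B' + D', hA.add hC, hB.add hD, fun h => ?_, fun h => ?_⟩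
  · simp only [add_apply, hA', hC', smul_add]; abel
  · simp only [add_apply, hB', hD', smul_add]; abel

lemma mul (h : HolPairAt A B z) (h' : HolPairAt C D z) :
    HolPairAt (fun z => A z * C z - B z * D z) (fun z => A z * D z + B z * C z) z := by
  obtain ⟨a, b, A', B', hA, hB, hA', hB'⟩ := h
  obtain ⟨c, d, C', D', hC, hD, hC', hD'⟩ := h'
  -- The real and imaginary parts of (a + ib)(C + iD) + (A + iB)(c + id), with the order of the
  -- factors kept.
  refine ⟨a * C z + A z * c - b * D z - B z * d, b * C z + A z * d + a * D z + B z * c, _, _,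
    (hA.mul' hC).sub (hB.mul' hD), (hA.mul' hD).add (hB.mul' hC), fun h => ?_, fun h => ?_⟩
  · simp [hA', hB', hC', hD', mul_add, mul_sub, smul_add, smul_sub]; abel
  · simp [hA', hB', hC', hD', mul_add, mul_sub, smul_add, smul_sub]; abel

lemma const_mul (h : HolPairAt A B z) (c : 𝓑) :
    HolPairAt (fun z => c * A z) (fun z => c * B z) z := by
  simpa using (const c z).mul h

lemma mul_const (h : HolPairAt A B z) (c : 𝓑) :
    HolPairAt (fun z => A z * c) (fun z => B z * c) z := by
  simpa using h.mul (const c z)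

lemma const_smul (h : HolPairAt A B z) (c : ℝ) :
    HolPairAt (fun z => c • A z) (fun z => c • B z) z := by
  simpa using h.const_mul (c • (1 : 𝓑))

lemma sub (h : HolPairAt A B z) (h' : HolPairAt C D z) :
    HolPairAt (fun z => A z - C z) (fun z => B z - D z) z := by
  simpa [sub_eq_add_neg] using h.add (h'.const_smul (-1))

/-- Applying a real functional to a holomorphic pair gives a holomorphic function. -/
lemma differentiableAt_dual (h : HolPairAt A B z) (ℓ : StrongDual ℝ 𝓑) :
    DifferentiableAt ℂ (fun z => (ℓ (A z) : ℂ) + ℓ (B z) * Complex.I) z := by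
  obtain ⟨a, b, A', B', hA, hB, hA', hB'⟩ := h
  have h1 : HasFDerivAt (fun z => (ℓ (A z) : ℂ) + ℓ (B z) * Complex.I)
      (Complex.ofRealCLM ∘L ℓ ∘L A' + Complex.I • (Complex.ofRealCLM ∘L ℓ ∘L B')) z := by
    have hA1 : HasFDerivAt (fun z => (ℓ (A z) : ℂ)) (Complex.ofRealCLM ∘L ℓ ∘L A') z :=
      (Complex.ofRealCLM ∘L ℓ).hasFDerivAt.comp z hA
    have hB1 : HasFDerivAt (fun z => (ℓ (B z) : ℂ)) (Complex.ofRealCLM ∘L ℓ ∘L B') z :=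
      (Complex.ofRealCLM ∘L ℓ).hasFDerivAt.comp z hB
    exact hA1.add (hB1.mul_const Complex.I)
  have h2 : HasFDerivAt (fun z => (ℓ (A z) : ℂ) + ℓ (B z) * Complex.I)
      ((ContinuousLinearMap.toSpanSingleton ℂ
        ((ℓ a : ℂ) + ℓ b * Complex.I)).restrictScalars ℝ) z := by
    refine h1.congr_fderiv (ContinuousLinearMap.ext fun w => ?_)
    apply Complex.ext <;>
      simp [hA', hB', ContinuousLinearMap.toSpanSingleton_apply]
  exact (hasFDerivAt_of_restrictScalars ℝ h2 rfl).differentiableAt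

end HolPairAt

/-- The element `u + j v` of `𝓑`, for `z = u + i v`. -/
def slicePoint (j : 𝓑) (z : ℂ) : 𝓑 := z.re • 1 + z.im • j

/-- `z ↦ slicePoint j z` as a continuous linear map. -/
noncomputable def slicePointCLM (j : 𝓑) : ℂ →L[ℝ] 𝓑 :=
  Complex.reCLM.smulRight 1 + Complex.imCLM.smulRight j

lemma slicePointCLM_apply (j : 𝓑) (z : ℂ) : slicePointCLM j z = slicePoint j z := by
  simp [slicePointCLM, slicePoint]

/-- Complex differentiability of `p + i q` follows from that of `p + q j` and `p - q j`, with
respect to the complex structures given by right multiplication with `j` and `-j`. -/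
lemma holPairAt_of_hasFDerivAt {j : 𝓑} (hj : j * j = -1) {p q : ℂ → 𝓑} {z : ℂ} {G G' : 𝓑}
    {L L' : ℂ →L[ℝ] 𝓑}
    (h : HasFDerivAt (fun z => p z + q z * j) L z) (hL : ∀ w, L w = G * slicePoint j w)
    (h' : HasFDerivAt (fun z => p z + q z * -j) L' z) (hL' : ∀ w, L' w = G' * slicePoint (-j) w) :
    HolPairAt p q z := by
  have hp : HasFDerivAt p ((1 / 2 : ℝ) • (L + L')) z := by
    refine ((h.add h').const_smul (1 / 2 : ℝ)).congr_of_eventuallyEq (Eventually.of_forall ?_)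
    intro w
    have : p w + q w * j + (p w + q w * -j) = (2 : ℝ) • p w := by
      rw [two_smul, mul_neg]; abel
    change p w = (1 / 2 : ℝ) • (p w + q w * j + (p w + q w * -j))
    rw [this, smul_smul]; norm_num
  -- As j² = -1, right multiplication by j / 2 recovers q from (p - q j) - (p + q j) = -2 q j.
  have hq : HasFDerivAt q ((ContinuousLinearMap.mul ℝ 𝓑).flip ((1 / 2 : ℝ) • j) ∘L (L' - L)) z := by
    refine (((ContinuousLinearMap.mul ℝ 𝓑).flip ((1 / 2 : ℝ) • j)).hasFDerivAt.comp z
      (h'.sub h)).congr_of_eventuallyEq (Eventually.of_forall ?_)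
    intro w
    have : p w + q w * -j - (p w + q w * j) = -((2 : ℝ) • (q w * j)) := by
      rw [two_smul, mul_neg]; abel
    change q w = (p w + q w * -j - (p w + q w * j)) * ((1 / 2 : ℝ) • j)
    rw [this, mul_smul_comm, neg_mul, smul_mul_assoc, mul_assoc, hj, mul_neg_one]
    simp only [smul_neg, neg_neg, smul_smul]
    norm_num
  refine ⟨(1 / 2 : ℝ) • (G + G'), (1 / 2 : ℝ) • ((G' - G) * j), _, _, hp, hq, fun w => ?_,
    fun w => ?_⟩
  · simp only [smul_apply, add_apply, hL, hL', slicePoint,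
      mul_add, sub_mul, smul_add, smul_sub, mul_smul_comm, mul_one, mul_neg, smul_neg]
    simp only [smul_comm w.im (1 / 2 : ℝ), smul_comm w.re (1 / 2 : ℝ)]
    abel
  · simp only [ContinuousLinearMap.comp_apply, ContinuousLinearMap.flip_apply,
      ContinuousLinearMap.mul_apply', sub_apply, hL, hL', slicePoint,
      mul_add, add_mul, sub_mul, smul_add, smul_sub, mul_smul_comm, smul_mul_assoc, mul_one,
      mul_neg, smul_neg, mul_assoc, hj, neg_mul]
    simp only [smul_comm w.im (1 / 2 : ℝ), smul_comm w.re (1 / 2 : ℝ), neg_neg]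
    abel

end HolPair

/-! ### Intrinsic functions -/

section Intrinsic

variable {𝓑 σ : Type*} [NormedRing 𝓑] [NormedAlgebra ℝ 𝓑]

/-- `K j z = p z + q z (e j)` for all imaginary units `e j`, with a holomorphic pair `(p, q)` of
functions whose values commute with all `e j`. -/
def IsIntrinsicOn (e : σ → 𝓑) (Ω : Set ℂ) (K : σ → ℂ → 𝓑) : Prop :=
  ∃ p q : ℂ → 𝓑, ∀ z ∈ Ω, HolPairAt p q z ∧
    ∀ j, Commute (p z) (e j) ∧ Commute (q z) (e j) ∧ K j z = p z + q z * e j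

variable {e : σ → 𝓑} {Ω : Set ℂ} {K K' : σ → ℂ → 𝓑}

namespace IsIntrinsicOn

lemma slicePoint : IsIntrinsicOn e Ω (fun j z => slicePoint (e j) z) :=
  ⟨_, _, fun z _ => ⟨HolPairAt.id z, fun j => ⟨(Commute.one_left (e j)).smul_left _,
    (Commute.one_left (e j)).smul_left _, by simp [_root_.slicePoint]⟩⟩⟩

lemma const {c : 𝓑} (hc : ∀ j, Commute c (e j)) : IsIntrinsicOn e Ω (fun _ _ => c) :=
  ⟨_, _, fun z _ => ⟨HolPairAt.const c z, fun j => ⟨hc j, Commute.zero_left _, by simp⟩⟩⟩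

lemma add (h : IsIntrinsicOn e Ω K) (h' : IsIntrinsicOn e Ω K') :
    IsIntrinsicOn e Ω (fun j z => K j z + K' j z) := by
  obtain ⟨p, q, h⟩ := h
  obtain ⟨p', q', h'⟩ := h'
  refine ⟨_, _, fun z hz => ⟨(h z hz).1.add (h' z hz).1, fun j => ?_⟩⟩
  obtain ⟨h1, h2, h3⟩ := (h z hz).2 j
  obtain ⟨h1', h2', h3'⟩ := (h' z hz).2 j
  refine ⟨h1.add_left h1', h2.add_left h2', ?_⟩
  beta_reduce
  rw [h3, h3', add_mul]; abel

/-- Because the coefficients commute with `e j`, this unit can be moved to the right and multiplies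
like i. The coefficients need not commute with each other. -/
lemma mul (he : ∀ j, e j * e j = -1) (h : IsIntrinsicOn e Ω K) (h' : IsIntrinsicOn e Ω K') :
    IsIntrinsicOn e Ω (fun j z => K j z * K' j z) := by
  obtain ⟨p, q, h⟩ := h
  obtain ⟨p', q', h'⟩ := h'
  refine ⟨_, _, fun z hz => ⟨(h z hz).1.mul (h' z hz).1, fun j => ?_⟩⟩
  obtain ⟨h1, h2, h3⟩ := (h z hz).2 j
  obtain ⟨h1', h2', h3'⟩ := (h' z hz).2 j
  refine ⟨(h1.mul_left h1').sub_left (h2.mul_left h2'),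
    (h1.mul_left h2').add_left (h2.mul_left h1'), ?_⟩
  have e1 : q z * e j * p' z = q z * p' z * e j := by rw [mul_assoc, ← h1'.eq, mul_assoc]
  have e2 : q z * e j * (q' z * e j) = -(q z * q' z) := by
    rw [mul_assoc, ← mul_assoc (e j), ← h2'.eq, mul_assoc (q' z), he j, mul_neg_one, mul_neg]
  beta_reduce
  rw [h3, h3', mul_add, add_mul, add_mul, e1, e2, add_mul, ← mul_assoc]
  abel

lemma pow (he : ∀ j, e j * e j = -1) (h : IsIntrinsicOn e Ω K) (n : ℕ) :
    IsIntrinsicOn e Ω (fun j z => K j z ^ n) := by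
  induction n with
  | zero => simpa using const fun j => Commute.one_left (e j)
  | succ n ih => simpa only [pow_succ] using ih.mul he h

lemma const_smul (h : IsIntrinsicOn e Ω K) (c : ℝ) :
    IsIntrinsicOn e Ω (fun j z => c • K j z) := by
  obtain ⟨p, q, h⟩ := h
  refine ⟨_, _, fun z hz => ⟨(h z hz).1.const_smul c, fun j => ?_⟩⟩
  obtain ⟨h1, h2, h3⟩ := (h z hz).2 j
  exact ⟨h1.smul_left c, h2.smul_left c, by beta_reduce; rw [h3, smul_add, smul_mul_assoc]⟩

lemma sub (h : IsIntrinsicOn e Ω K) (h' : IsIntrinsicOn e Ω K') :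
    IsIntrinsicOn e Ω (fun j z => K j z - K' j z) := by
  simpa [sub_eq_add_neg] using h.add (h'.const_smul (-1))

end IsIntrinsicOn

/-- `K j z = A z + B z (e j)` for all imaginary units `e j`, with a holomorphic pair `(A, B)`. -/
def IsRightStemOn (e : σ → 𝓑) (Ω : Set ℂ) (K : σ → ℂ → 𝓑) : Prop :=
  ∃ A B : ℂ → 𝓑, ∀ z ∈ Ω, HolPairAt A B z ∧ ∀ j, K j z = A z + B z * e j

/-- `K j z = A z + (e j) B z` for all imaginary units `e j`, with a holomorphic pair `(A, B)`. -/
def IsLeftStemOn (e : σ → 𝓑) (Ω : Set ℂ) (K : σ → ℂ → 𝓑) : Prop :=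
  ∃ A B : ℂ → 𝓑, ∀ z ∈ Ω, HolPairAt A B z ∧ ∀ j, K j z = A z + e j * B z

lemma IsIntrinsicOn.isRightStemOn (h : IsIntrinsicOn e Ω K) : IsRightStemOn e Ω K := by
  obtain ⟨p, q, h⟩ := h
  exact ⟨p, q, fun z hz => ⟨(h z hz).1, fun j => ((h z hz).2 j).2.2⟩⟩

lemma IsIntrinsicOn.isLeftStemOn (h : IsIntrinsicOn e Ω K) : IsLeftStemOn e Ω K := by
  obtain ⟨p, q, h⟩ := h
  refine ⟨p, q, fun z hz => ⟨(h z hz).1, fun j => ?_⟩⟩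
  obtain ⟨_, h2, h3⟩ := (h z hz).2 j
  rw [h3, h2.eq]

/-- A constant on the left stays away from `e j`, which stands on the right, so it need not commute
with the units. This is what admits c = T̄. -/
lemma IsRightStemOn.sub_const_mul (h : IsRightStemOn e Ω K) (h' : IsRightStemOn e Ω K') (c : 𝓑) :
    IsRightStemOn e Ω (fun j z => K j z - c * K' j z) := by
  obtain ⟨A, B, h⟩ := h
  obtain ⟨C, D, h'⟩ := h'
  refine ⟨_, _, fun z hz => ⟨(h z hz).1.sub ((h' z hz).1.const_mul c), fun j => ?_⟩⟩
  beta_reduce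
  rw [(h z hz).2 j, (h' z hz).2 j, mul_add, sub_mul, mul_assoc]; abel

lemma IsLeftStemOn.sub_mul_const (h : IsLeftStemOn e Ω K) (h' : IsLeftStemOn e Ω K') (c : 𝓑) :
    IsLeftStemOn e Ω (fun j z => K j z - K' j z * c) := by
  obtain ⟨A, B, h⟩ := h
  obtain ⟨C, D, h'⟩ := h'
  refine ⟨_, _, fun z hz => ⟨(h z hz).1.sub ((h' z hz).1.mul_const c), fun j => ?_⟩⟩
  beta_reduce
  rw [(h z hz).2 j, (h' z hz).2 j, add_mul, mul_sub, mul_assoc]; abel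

lemma IsRightStemOn.add (h : IsRightStemOn e Ω K) (h' : IsRightStemOn e Ω K') :
    IsRightStemOn e Ω (fun j z => K j z + K' j z) := by
  simpa [sub_eq_add_neg] using h.sub_const_mul h' (-1)

lemma IsLeftStemOn.add (h : IsLeftStemOn e Ω K) (hK' : IsLeftStemOn e Ω K') :
    IsLeftStemOn e Ω (fun j z => K j z + K' j z) := by
  simpa [sub_eq_add_neg] using h.sub_mul_const hK' (-1)

/-! ### The inverse of a quadratic polynomial -/

/-- The quadratic polynomial `x² - 2 x t + n` at `x = u + j v`. -/
def quad (t n : 𝓑) (j : 𝓑) (z : ℂ) : 𝓑 :=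
  slicePoint j z ^ 2 - slicePoint j z * (t + t) + n

/-- The part `a` of `quad t n j z = a + b j`. -/
def quadRe (t n : 𝓑) (z : ℂ) : 𝓑 := (z.re ^ 2 - z.im ^ 2) • 1 - (2 * z.re) • t + n

/-- The part `b` of `quad t n j z = a + b j`. -/
def quadIm (t : 𝓑) (z : ℂ) : 𝓑 := (2 * z.im) • (z.re • 1 - t)

/-- The product of `quad t n j z` and `quad t n (-j) z`. -/
def quadNorm (t n : 𝓑) (z : ℂ) : 𝓑 := quadRe t n z * quadRe t n z + quadIm t z * quadIm t z

variable {t n j : 𝓑} {z : ℂ}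

lemma quad_eq (hj : j * j = -1) (ht : Commute t j) :
    quad t n j z = quadRe t n z + quadIm t z * j := by
  simp only [quad, quadRe, quadIm, slicePoint, sq, add_mul, mul_add, smul_mul_assoc, mul_smul_comm,
    one_mul, mul_one, hj, smul_add, smul_sub, sub_mul, smul_smul, ← ht.eq]
  match_scalars <;> ring

lemma quadRe_commute_quadIm (htn : Commute t n) : Commute (quadRe t n z) (quadIm t z) := by
  have h1 : Commute (quadRe t n z) t :=
    (((Commute.one_left t).smul_left _).sub_left ((Commute.refl t).smul_left _)).add_left htn.symm
  exact (((Commute.one_right _).smul_right _).sub_right h1).smul_right _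

lemma Commute.quadRe_left {c : 𝓑} (ht : Commute t c) (hn : Commute n c) :
    Commute (quadRe t n z) c :=
  (((Commute.one_left c).smul_left _).sub_left (ht.smul_left _)).add_left hn

lemma Commute.quadIm_left {c : 𝓑} (ht : Commute t c) : Commute (quadIm t z) c :=
  (((Commute.one_left c).smul_left _).sub_left ht).smul_left _

lemma Commute.quad_left {c : 𝓑} (ht : Commute t c) (hn : Commute n c) (hj : Commute j c) :
    Commute (quad t n j z) c := by
  have hx : Commute (slicePoint j z) c :=
    ((Commute.one_left c).smul_left _).add_left (hj.smul_left _)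
  exact ((hx.pow_left 2).sub_left (hx.mul_left (ht.add_left ht))).add_left hn

/-- Since a, b and j commute, (a + b j)(a - b j) = a² + b². The unit j has disappeared, so
invertibility of the norm is a condition on z alone. -/
lemma quad_mul_quad_neg (hj : j * j = -1) (ht : Commute t j) (hn : Commute n j)
    (htn : Commute t n) : quad t n j z * quad t n (-j) z = quadNorm t n z := by
  rw [quad_eq hj ht, quad_eq (by simpa using hj) ht.neg_right, quadNorm]
  have ha : Commute (quadRe t n z) j := ht.quadRe_left hn
  have hb : Commute (quadIm t z) j := ht.quadIm_left
  have hab : Commute (quadRe t n z) (quadIm t z) := quadRe_commute_quadIm htn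
  generalize quadRe t n z = a at *
  generalize quadIm t z = b at *
  have e1 : b * j * a = a * b * j := by rw [mul_assoc, ← ha.eq, ← mul_assoc, hab.eq]
  have e2 : b * j * (b * j) = -(b * b) := by
    rw [mul_assoc, ← mul_assoc j, ← hb.eq, mul_assoc b j, hj, mul_neg_one, mul_neg]
  rw [mul_neg, add_mul, mul_add, mul_add, mul_neg, mul_neg, e1, e2, ← mul_assoc]
  abel

/-- The inverse of `quad t n j z` in the form `p + q j`. -/
lemma inverse_quad_eq (hj : j * j = -1) (ht : Commute t j) (hn : Commute n j)
    (htn : Commute t n) (hz : IsUnit (quadNorm t n z)) :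
    IsUnit (quad t n j z) ∧ Ring.inverse (quad t n j z) =
      quadRe t n z * Ring.inverse (quadNorm t n z) +
        -(quadIm t z * Ring.inverse (quadNorm t n z)) * j := by
  have hnegj : -j * -j = -1 := by simpa using hj
  have h1 := quad_mul_quad_neg (z := z) hj ht hn htn
  have h2 := quad_mul_quad_neg (z := z) hnegj ht.neg_right hn.neg_right htn
  rw [neg_neg] at h2
  have hc : Commute (quad t n j z) (quadNorm t n z) := by
    rw [← h1]; exact (Commute.refl _).mul_right (h1.trans h2.symm)
  have hR : Commute (Ring.inverse (quadNorm t n z)) (quad t n j z) := hc.symm.ringInverse_left'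
  have hRj : Commute (Ring.inverse (quadNorm t n z)) j :=
    Commute.ringInverse_left' (((ht.quadRe_left hn).mul_left (ht.quadRe_left hn)).add_left
      (ht.quadIm_left.mul_left ht.quadIm_left))
  have hl : quad t n j z * (quad t n (-j) z * Ring.inverse (quadNorm t n z)) = 1 := by
    rw [← mul_assoc, h1, Ring.mul_inverse_cancel _ hz]
  have hr : (quad t n (-j) z * Ring.inverse (quadNorm t n z)) * quad t n j z = 1 := by
    rw [mul_assoc, hR.eq, ← mul_assoc, h2, Ring.mul_inverse_cancel _ hz]
  refine ⟨(⟨_, _, hl, hr⟩ : 𝓑ˣ).isUnit, ?_⟩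
  rw [Ring.inverse_eq_of_mul_eq_one hl hr, quad_eq hnegj ht.neg_right, add_mul, mul_neg, neg_mul,
    neg_mul, mul_assoc, ← hRj.eq, mul_assoc]

/-- All factors of the derivative commute with `slicePoint j w`, which can be moved to the far
right: the derivative is linear for the complex structure of right multiplication by j. -/
lemma hasFDerivAt_inverse_quad [CompleteSpace 𝓑] (ht : Commute t j) (hn : Commute n j)
    (hz : IsUnit (quad t n j z)) : ∃ (G : 𝓑) (L : ℂ →L[ℝ] 𝓑),
      HasFDerivAt (fun z => Ring.inverse (quad t n j z)) L z ∧ ∀ w, L w = G * slicePoint j w := by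
  have hx : HasFDerivAt (slicePoint j) (slicePointCLM j) z := by
    have := (slicePointCLM j).hasFDerivAt (x := z)
    simpa only [funext (slicePointCLM_apply j)] using! this
  have hQ : HasFDerivAt (quad t n j) _ z :=
    (((hx.mul' hx).sub (hx.mul_const' (t + t))).add_const n).congr_of_eventuallyEq
      (Eventually.of_forall fun w => by simp [quad, sq])
  obtain ⟨u, hu⟩ := hz
  have hI := hasFDerivAt_ringInverse (𝕜 := ℝ) u
  rw [hu] at hI
  refine ⟨-(↑u⁻¹ * (slicePoint j z + slicePoint j z - (t + t)) * ↑u⁻¹), _, hI.comp z hQ,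
    fun w => ?_⟩
  have hjs : ∀ w, Commute j (slicePoint j w) := fun w =>
    ((Commute.one_right j).smul_right _).add_right ((Commute.refl j).smul_right _)
  have hsw : ∀ c : 𝓑, Commute c j → Commute c (slicePoint j w) := fun c hc =>
    ((Commute.one_right c).smul_right _).add_right (hc.smul_right _)
  have hu' : Commute (↑u⁻¹ : 𝓑) (slicePoint j w) := by
    refine hsw _ (Commute.units_inv_left ?_)
    rw [hu]
    exact ht.quad_left hn (Commute.refl j)
  have h1 : Commute (slicePoint j z) (slicePoint j w) := hsw _ (hjs z).symm
  have h2 : Commute t (slicePoint j w) := hsw _ ht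
  have h3 : (slicePoint j z * slicePoint j w + slicePoint j w * slicePoint j z
      - slicePoint j w * (t + t)) =
      (slicePoint j z + slicePoint j z - (t + t)) * slicePoint j w := by
    rw [← h1.eq, ← (h2.add_left h2).eq]; noncomm_ring
  have h4 : (-(↑u⁻¹ * (slicePoint j z + slicePoint j z - (t + t)) * ↑u⁻¹)) * slicePoint j w =
      -(↑u⁻¹ * ((slicePoint j z + slicePoint j z - (t + t)) * slicePoint j w) * ↑u⁻¹) := by
    rw [neg_mul, mul_assoc _ (↑u⁻¹ : 𝓑) (slicePoint j w), hu'.eq]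
    simp only [mul_assoc]
  rw [h4, ← h3]
  simp [slicePointCLM_apply, mul_sub, mul_add, sub_mul, add_mul]
  abel

lemma continuous_quadNorm (t n : 𝓑) : Continuous (quadNorm t n) := by
  unfold quadNorm quadRe quadIm
  have := Complex.continuous_re
  have := Complex.continuous_im
  fun_prop

lemma quadNorm_conj (t n : 𝓑) (z : ℂ) :
    quadNorm t n ((starRingEnd ℂ) z) = quadNorm t n z := by
  simp [quadNorm, quadRe, quadIm]

lemma isOpen_isUnit_quadNorm [CompleteSpace 𝓑] (t n : 𝓑) : IsOpen {z | IsUnit (quadNorm t n z)} :=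
  Units.isOpen.preimage (continuous_quadNorm t n)

/-- The inverse of `quad t n j z` is an intrinsic function. -/
lemma isIntrinsicOn_inverse_quad [CompleteSpace 𝓑] (he : ∀ j, e j * e j = -1) [Nonempty σ]
    (ht : ∀ j, Commute t (e j)) (hn : ∀ j, Commute n (e j)) (htn : Commute t n)
    (hΩ : ∀ z ∈ Ω, IsUnit (quadNorm t n z)) :
    IsIntrinsicOn e Ω (fun j z => Ring.inverse (quad t n (e j) z)) := by
  obtain ⟨i⟩ := ‹Nonempty σ›
  refine ⟨fun z => quadRe t n z * Ring.inverse (quadNorm t n z),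
    fun z => -(quadIm t z * Ring.inverse (quadNorm t n z)), fun z hz => ⟨?_, fun j => ?_⟩⟩
  · have hev : ∀ᶠ w in 𝓝 z, IsUnit (quadNorm t n w) :=
      (isOpen_isUnit_quadNorm t n).mem_nhds (hΩ z hz)
    have key : ∀ j : 𝓑, j * j = -1 → Commute t j → Commute n j → ∃ (G : 𝓑) (L : ℂ →L[ℝ] 𝓑),
        HasFDerivAt (fun z => quadRe t n z * Ring.inverse (quadNorm t n z) +
          -(quadIm t z * Ring.inverse (quadNorm t n z)) * j) L z ∧
          ∀ w, L w = G * slicePoint j w := by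
      intro j hj htj hnj
      obtain ⟨G, L, hL, hG⟩ :=
        hasFDerivAt_inverse_quad htj hnj (inverse_quad_eq hj htj hnj htn (hΩ z hz)).1
      refine ⟨G, L, hL.congr_of_eventuallyEq ?_, hG⟩
      filter_upwards [hev] with w hw
      exact (inverse_quad_eq hj htj hnj htn hw).2.symm
    -- The same p and q serve every unit, so the derivatives at one unit and at its negative already
    -- determine those of p and q.
    obtain ⟨G, L, hL, hG⟩ := key (e i) (he i) (ht i) (hn i)
    obtain ⟨G', L', hL', hG'⟩ := key (-e i) (by simpa using he i) (ht i).neg_right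
      (hn i).neg_right
    exact holPairAt_of_hasFDerivAt (he i) hL hG hL' hG'
  · have hRj : Commute (Ring.inverse (quadNorm t n z)) (e j) :=
      Commute.ringInverse_left' ((((ht j).quadRe_left (hn j)).mul_left
        ((ht j).quadRe_left (hn j))).add_left
        ((ht j).quadIm_left.mul_left (ht j).quadIm_left))
    exact ⟨((ht j).quadRe_left (hn j)).mul_left hRj,
      ((ht j).quadIm_left.mul_left hRj).neg_left,
      (inverse_quad_eq (he j) (ht j) (hn j) htn (hΩ z hz)).2⟩

end Intrinsic

/-! ### Integrals over positively oriented boundaries -/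

namespace FineStructure.IsPiecewiseC1Jordan

variable {γ : ℝ → ℂ}

lemma continuousOn (h : IsPiecewiseC1Jordan γ) : ContinuousOn γ (Icc 0 1) := by
  obtain ⟨m, t, ht, h0, h1, hC⟩ := h.pieces
  have key : ∀ k ≤ m, ContinuousOn γ (Icc (t 0) (t k)) := by
    intro k
    induction k with
    | zero => intro _; simp
    | succ k ih =>
      intro hk
      rw [← Icc_union_Icc_eq_Icc (ht (Nat.zero_le k)) (ht (Nat.le_succ k))]
      exact (ih (by omega)).union_of_isClosed (hC k (by omega)).continuousOn isClosed_Icc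
        isClosed_Icc
  simpa [h0, h1] using key m le_rfl

lemma intervalIntegrable_deriv (h : IsPiecewiseC1Jordan γ) :
    IntervalIntegrable (deriv γ) volume 0 1 := by
  obtain ⟨m, t, ht, h0, h1, hC⟩ := h.pieces
  rw [← h0, ← h1]
  refine IntervalIntegrable.trans_iterate fun k hk => ?_
  rcases (ht (Nat.le_succ k)).eq_or_lt with heq | hlt
  · rw [Nat.succ_eq_add_one] at heq
    simp [heq]
  -- At the nodes `deriv γ` may be the default value 0, so it is compared with the one-sided
  -- derivative only inside the piece.
  · have hcont : ContinuousOn (derivWithin γ (Icc (t k) (t (k + 1)))) (Icc (t k) (t (k + 1))) :=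
      (hC k hk).continuousOn_derivWithin (uniqueDiffOn_Icc hlt) le_rfl
    refine (hcont.intervalIntegrable_of_Icc hlt.le).congr_uIoo fun x hx => ?_
    rw [uIoo_of_le hlt.le] at hx
    exact derivWithin_of_mem_nhds (Icc_mem_nhds hx.1 hx.2)

end FineStructure.IsPiecewiseC1Jordan

/-- The curves `γ` form the positively oriented boundary of a bounded open set `S` with `N ⊆ S` and
`closure S ⊆ X` that is symmetric with respect to the real axis. -/
structure IsSymmetricContour (X N S : Set ℂ) {n : ℕ} (γ : Fin n → ℝ → ℂ) : Prop where
  isOpen : IsOpen S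
  bounded : Bornology.IsBounded S
  subset : N ⊆ S
  closure_subset : closure S ⊆ X
  conj_mem : ∀ z ∈ S, conj z ∈ S
  positive : IsPositiveBoundary γ S

namespace IsSymmetricContour

variable {X N S S' : Set ℂ} {n n' : ℕ} {γ : Fin n → ℝ → ℂ} {γ' : Fin n' → ℝ → ℂ}

lemma continuousOn (h : IsSymmetricContour X N S γ) (i : Fin n) : ContinuousOn (γ i) (Icc 0 1) :=
  (h.positive.boundary.jordan i).continuousOn

lemma intervalIntegrable_deriv (h : IsSymmetricContour X N S γ) (i : Fin n) :
    IntervalIntegrable (deriv (γ i)) volume 0 1 :=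
  (h.positive.boundary.jordan i).intervalIntegrable_deriv

lemma mem_frontier (h : IsSymmetricContour X N S γ) (i : Fin n) {t : ℝ} (ht : t ∈ Icc (0 : ℝ) 1) :
    γ i t ∈ closure S \ S := by
  have : γ i t ∈ frontier S := by
    rw [← h.positive.boundary.union]
    exact mem_iUnion.2 ⟨i, mem_image_of_mem _ ht⟩
  rwa [h.isOpen.frontier_eq] at this

lemma mem_diff (h : IsSymmetricContour X N S γ) (i : Fin n) {t : ℝ} (ht : t ∈ Icc (0 : ℝ) 1) :
    γ i t ∈ X \ N :=
  ⟨h.closure_subset (h.mem_frontier i ht).1, fun hN => (h.mem_frontier i ht).2 (h.subset hN)⟩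

lemma sum_integral_inside (h : IsSymmetricContour X N S γ) {z : ℂ} (hz : z ∈ S) :
    ∑ i, ∫ t in (0 : ℝ)..1, deriv (γ i) t / (γ i t - z) = 2 * Real.pi * Complex.I := by
  have := h.positive.inside z hz
  rwa [windingNumber, inv_mul_eq_iff_eq_mul₀ Complex.two_pi_I_ne_zero, mul_one] at this

lemma sum_integral_outside (h : IsSymmetricContour X N S γ) {z : ℂ} (hz : z ∉ closure S) :
    ∑ i, ∫ t in (0 : ℝ)..1, deriv (γ i) t / (γ i t - z) = 0 := by
  have := h.positive.outside z hz
  rwa [windingNumber, inv_mul_eq_iff_eq_mul₀ Complex.two_pi_I_ne_zero, mul_zero] at this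

/-- The set consists of the points inside both contours or outside both, where the winding numbers
agree. It covers the complement of X \ N because N lies inside both contours and the complement of X
outside both. -/
lemma isBounded_compl (h : IsSymmetricContour X N S γ) (h' : IsSymmetricContour X N S' γ') :
    Bornology.IsBounded (S ∩ S' ∪ (closure S)ᶜ ∩ (closure S')ᶜ)ᶜ := by
  refine (h.bounded.closure.union h'.bounded.closure).subset fun z hz => ?_
  by_contra hz'
  rw [mem_union, not_or] at hz'
  exact hz (Or.inr hz')

lemma isOpen_inter_union (h : IsSymmetricContour X N S γ) (h' : IsSymmetricContour X N S' γ') :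
    IsOpen (S ∩ S' ∪ (closure S)ᶜ ∩ (closure S')ᶜ) :=
  (h.isOpen.inter h'.isOpen).union
    (isClosed_closure.isOpen_compl.inter isClosed_closure.isOpen_compl)

lemma union_eq_univ (h : IsSymmetricContour X N S γ) (h' : IsSymmetricContour X N S' γ') :
    X \ N ∪ (S ∩ S' ∪ (closure S)ᶜ ∩ (closure S')ᶜ) = univ := by
  refine eq_univ_of_forall fun z => ?_
  by_cases hN : z ∈ N
  · exact Or.inr (Or.inl ⟨h.subset hN, h'.subset hN⟩)
  · by_cases hX : z ∈ X
    · exact Or.inl ⟨hX, hN⟩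
    · exact Or.inr (Or.inr ⟨fun hz => hX (h.closure_subset hz),
        fun hz => hX (h'.closure_subset hz)⟩)

/-- The integral of a holomorphic function does not depend on the contour. -/
lemma sum_integral_eq (h : IsSymmetricContour X N S γ) (h' : IsSymmetricContour X N S' γ')
    (hΩ : IsOpen (X \ N)) {F : ℂ → ℂ} (hF : DifferentiableOn ℂ F (X \ N)) :
    ∑ i, ∫ t in (0 : ℝ)..1, F (γ i t) * deriv (γ i) t =
      ∑ i, ∫ t in (0 : ℝ)..1, F (γ' i t) * deriv (γ' i) t := by
  -- The cycle γ - γ'; the minus sign is put into the weights.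
  have key := sum_integral_eq_zero (ι := Fin n ⊕ Fin n') (γ := Sum.elim γ γ')
    (g := Sum.elim (fun i => deriv (γ i)) (fun i t => -deriv (γ' i) t)) hΩ
    (h.isOpen_inter_union h') (h.union_eq_univ h') (h.isBounded_compl h') ?_ ?_ ?_ ?_ ?_ hF
  · simpa only [Fintype.sum_sum_type, Sum.elim_inl, Sum.elim_inr, mul_neg,
      intervalIntegral.integral_neg, Finset.sum_neg_distrib, ← sub_eq_add_neg, sub_eq_zero]
      using key
  · rintro (i | i)
    exacts [h.continuousOn i, h'.continuousOn i]
  · rintro (i | i)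
    exacts [h.intervalIntegrable_deriv i, (h'.intervalIntegrable_deriv i).neg]
  · rintro (i | i) t ht
    exacts [h.mem_diff i ht, h'.mem_diff i ht]
  · rintro (i | i) t ht (hz | hz)
    exacts [(h.mem_frontier i ht).2 hz.1, hz.1 (h.mem_frontier i ht).1,
      (h'.mem_frontier i ht).2 hz.2, hz.2 (h'.mem_frontier i ht).1]
  · intro z hz
    simp only [Fintype.sum_sum_type, Sum.elim_inl, Sum.elim_inr, neg_div,
      intervalIntegral.integral_neg, Finset.sum_neg_distrib, ← sub_eq_add_neg, sub_eq_zero]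
    rcases hz with hz | hz
    · rw [h.sum_integral_inside hz.1, h'.sum_integral_inside hz.2]
    · rw [h.sum_integral_outside hz.1, h'.sum_integral_outside hz.2]

lemma integral_conj_eq (f : ℝ → ℂ) :
    ∫ t in (0 : ℝ)..1, conj (f t) = conj (∫ t in (0 : ℝ)..1, f t) := by
  rw [intervalIntegral.integral_of_le zero_le_one, intervalIntegral.integral_of_le zero_le_one,
    integral_conj]

/-- The integral of a holomorphic function that is symmetric with respect to the real axis is
purely imaginary. -/
lemma re_sum_integral_eq_zero (h : IsSymmetricContour X N S γ) (hΩ : IsOpen (X \ N)) {F : ℂ → ℂ}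
    (hF : DifferentiableOn ℂ F (X \ N)) (hconj : ∀ z ∈ X \ N, conj z ∈ X \ N)
    (hFc : ∀ z ∈ X \ N, F (conj z) = conj (F z)) :
    (∑ i, ∫ t in (0 : ℝ)..1, F (γ i t) * deriv (γ i) t).re = 0 := by
  have hcl : ∀ z ∈ closure S, conj z ∈ closure S := fun z hz =>
    map_mem_closure Complex.continuous_conj hz h.conj_mem
  have hS' : ∀ z, conj z ∈ S → z ∈ S := fun z hz => by simpa using h.conj_mem _ hz
  have hcl' : ∀ z, conj z ∈ closure S → z ∈ closure S := fun z hz => by simpa using hcl _ hz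
  -- Reflection reverses the orientation, so the Cauchy transform of γ together with its mirror
  -- image is 2πi + conj(2πi) = 0 inside. The integral I over γ thus satisfies I + conj I = 0.
  have key := sum_integral_eq_zero (ι := Fin n ⊕ Fin n)
    (γ := Sum.elim γ (fun i t => conj (γ i t)))
    (g := Sum.elim (fun i => deriv (γ i)) (fun i t => conj (deriv (γ i) t))) hΩ
    (h.isOpen_inter_union h) (h.union_eq_univ h) (h.isBounded_compl h) ?_ ?_ ?_ ?_ ?_ hF
  · simp only [Fintype.sum_sum_type, Sum.elim_inl, Sum.elim_inr] at key
    have hc : ∑ i, ∫ t in (0 : ℝ)..1, F (conj (γ i t)) * conj (deriv (γ i) t) =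
        conj (∑ i, ∫ t in (0 : ℝ)..1, F (γ i t) * deriv (γ i) t) := by
      rw [map_sum]
      refine Finset.sum_congr rfl fun i _ => ?_
      rw [← integral_conj_eq]
      refine intervalIntegral.integral_congr fun t ht => ?_
      rw [uIcc_of_le zero_le_one] at ht
      simp only [map_mul]
      rw [hFc _ (h.mem_diff i ht)]
    rw [hc, Complex.add_conj, Complex.ofReal_eq_zero] at key
    linarith
  · rintro (i | i)
    exacts [h.continuousOn i, Complex.continuous_conj.comp_continuousOn (h.continuousOn i)]
  · rintro (i | i)
    · exact h.intervalIntegrable_deriv i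
    · have hi := h.intervalIntegrable_deriv i
      exact ⟨Complex.conjCLE.toContinuousLinearMap.integrable_comp hi.1,
        Complex.conjCLE.toContinuousLinearMap.integrable_comp hi.2⟩
  · rintro (i | i) t ht
    exacts [h.mem_diff i ht, hconj _ (h.mem_diff i ht)]
  · rintro (i | i) t ht (hz | hz)
    exacts [(h.mem_frontier i ht).2 hz.1, hz.1 (h.mem_frontier i ht).1,
      (h.mem_frontier i ht).2 (hS' _ hz.2), hz.2 (hcl _ (h.mem_frontier i ht).1)]
  · intro z hz
    simp only [Fintype.sum_sum_type, Sum.elim_inl, Sum.elim_inr]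
    have hc : ∑ i, ∫ t in (0 : ℝ)..1, conj (deriv (γ i) t) / (conj (γ i t) - z) =
        conj (∑ i, ∫ t in (0 : ℝ)..1, deriv (γ i) t / (γ i t - conj z)) := by
      rw [map_sum]
      refine Finset.sum_congr rfl fun i _ => ?_
      rw [← integral_conj_eq]
      simp
    rw [hc]
    rcases hz with hz | hz
    · rw [h.sum_integral_inside hz.1, h.sum_integral_inside (h.conj_mem z hz.1)]
      simp [Complex.conj_ofNat]
    · rw [h.sum_integral_outside hz.1, h.sum_integral_outside fun hz' => hz.1 (hcl' z hz')]
      simp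

end IsSymmetricContour

/-! ### Integrals of products of stem functions -/

section Core

variable {𝓑 σ : Type*} [NormedRing 𝓑] [NormedAlgebra ℝ 𝓑]

/-- The product of a right stem, the differential `ds (-j)` and a left stem, split into the part
that does not depend on `j` and the rest. -/
lemma stem_mul_stem_eq {j : 𝓑} (hj : j * j = -1) (A B C D : 𝓑) (w : ℂ) :
    (A + B * j) * (slicePoint j w * -j) * (C + j * D) =
      w.re • ((A * 1 * D + B * 1 * C) - (A * j * C - B * j * D)) +
        w.im • ((A * 1 * C - B * 1 * D) + (A * j * D + B * j * C)) := by
  -- With H c = (A + iB) c (C + iD), the right-hand side of the claim is Im(H 1 w) - Re(H j w); the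
  -- factors 1 are kept to exhibit this common form.
  have h1 : slicePoint j w * -j = w.im • 1 - w.re • j := by
    simp only [slicePoint, add_mul, smul_mul_assoc, one_mul, mul_neg, hj]
    simp only [smul_neg]; abel
  have h2 : ∀ x : 𝓑, j * (j * x) = -x := fun x => by rw [← mul_assoc, hj, neg_one_mul]
  rw [h1]
  simp only [mul_add, add_mul, mul_sub, sub_mul, smul_add, smul_sub, mul_smul_comm, smul_mul_assoc,
    mul_one, mul_assoc, h2, hj, mul_neg, smul_neg, neg_mul]
  abel

/-- Here `ν` is the antipodal map, and `L j` is left or right multiplication by the unit, so both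
kinds of stems are covered. Adding the equations at j and -j isolates A; `L j`, whose square is -1,
is then cancelled to get B. -/
lemma stem_conj_eq {L : σ → 𝓑 →+ 𝓑} (hL : ∀ j x, L j (L j x) = -x) {ν : σ → σ}
    (hν : ∀ j x, L (ν j) x = -L j x) [Nonempty σ] {Ω : Set ℂ} (hΩ : ∀ z ∈ Ω, conj z ∈ Ω)
    {K : σ → ℂ → 𝓑} (hK : ∀ j z, K (ν j) z = K j (conj z)) {A B : ℂ → 𝓑}
    (h : ∀ z ∈ Ω, ∀ j, K j z = A z + L j (B z)) {z : ℂ} (hz : z ∈ Ω) :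
    A (conj z) = A z ∧ B (conj z) = -B z := by
  obtain ⟨j⟩ := ‹Nonempty σ›
  have h1 := h _ (hΩ z hz) j
  rw [← hK, h z hz, hν] at h1
  have h2 := h _ (hΩ z hz) (ν j)
  rw [hK, Complex.conj_conj, h z hz, hν] at h2
  have hA : (2 : ℝ) • A (conj z) = (2 : ℝ) • A z := by
    rw [two_smul, two_smul]
    have h3 := congrArg₂ (· + ·) h1 h2
    rw [← sub_eq_zero] at h3 ⊢
    rw [← neg_eq_zero, ← h3]
    abel
  have hA' : A (conj z) = A z := smul_right_injective 𝓑 (two_ne_zero (α := ℝ)) hA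
  refine ⟨hA', ?_⟩
  rw [hA', add_right_inj] at h1
  have h3 := congrArg (L j) h1
  rw [map_neg, hL, hL, neg_neg] at h3
  rw [h3, neg_neg]

variable {e : σ → 𝓑} {ν : σ → σ} {X N S S' : Set ℂ} {n n' : ℕ}
  {γ : Fin n → ℝ → ℂ} {γ' : Fin n' → ℝ → ℂ} {K₁ K₂ : σ → ℂ → 𝓑}

/-- The integrand `K₁ ds (-j) K₂` along the curve `γ` in the plane of `j`. -/
noncomputable def stemIntegrand (e : σ → 𝓑) (K₁ K₂ : σ → ℂ → 𝓑) (j : σ) (γ : ℝ → ℂ) (t : ℝ) : 𝓑 :=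
  K₁ j (γ t) * (slicePoint (e j) (deriv γ t) * -e j) * K₂ j (γ t)

lemma intervalIntegrable_stemIntegrand (he : ∀ j, e j * e j = -1)
    (h₁ : IsRightStemOn e (X \ N) K₁) (h₂ : IsLeftStemOn e (X \ N) K₂)
    (hγ : IsSymmetricContour X N S γ) (j : σ) (i : Fin n) :
    IntervalIntegrable (stemIntegrand e K₁ K₂ j (γ i)) volume 0 1 := by
  obtain ⟨A, B, hAB⟩ := h₁
  obtain ⟨C, D, hCD⟩ := h₂
  have hcomp : ∀ G : ℂ → 𝓑, (∀ z ∈ X \ N, DifferentiableAt ℝ G z) →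
      ContinuousOn (fun t => G (γ i t)) (uIcc 0 1) := by
    intro G hG
    rw [uIcc_of_le zero_le_one]
    exact ContinuousOn.comp (g := G) (fun z hz => (hG z hz).continuousAt.continuousWithinAt)
      (hγ.continuousOn i) fun t ht => hγ.mem_diff i ht
  have hA := hcomp A fun z hz => (hAB z hz).1.differentiableAt_left
  have hB := hcomp B fun z hz => (hAB z hz).1.differentiableAt_right
  have hC := hcomp C fun z hz => (hCD z hz).1.differentiableAt_left
  have hD := hcomp D fun z hz => (hCD z hz).1.differentiableAt_right
  have hm : ∀ (c : 𝓑) {G H : ℝ → 𝓑}, ContinuousOn G (uIcc 0 1) → ContinuousOn H (uIcc 0 1) →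
      ContinuousOn (fun t => G t * c * H t) (uIcc 0 1) := fun c G H hG hH =>
    (hG.mul continuousOn_const).mul hH
  have hd := hγ.intervalIntegrable_deriv i
  have hre : IntervalIntegrable (fun t => (deriv (γ i) t).re) volume 0 1 :=
    ⟨Complex.reCLM.integrable_comp hd.1, Complex.reCLM.integrable_comp hd.2⟩
  have him : IntervalIntegrable (fun t => (deriv (γ i) t).im) volume 0 1 :=
    ⟨Complex.imCLM.integrable_comp hd.1, Complex.imCLM.integrable_comp hd.2⟩
  refine ((hre.smul_continuousOn (g := fun t => (A (γ i t) * 1 * D (γ i t) +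
    B (γ i t) * 1 * C (γ i t)) - (A (γ i t) * e j * C (γ i t) - B (γ i t) * e j * D (γ i t)))
    (((hm 1 hA hD).add (hm 1 hB hC)).sub ((hm (e j) hA hC).sub (hm (e j) hB hD)))).add
    (him.smul_continuousOn (g := fun t => (A (γ i t) * 1 * C (γ i t) -
    B (γ i t) * 1 * D (γ i t)) + (A (γ i t) * e j * D (γ i t) + B (γ i t) * e j * C (γ i t)))
    (((hm 1 hA hC).sub (hm 1 hB hD)).add ((hm (e j) hA hD).add (hm (e j) hB hC))))).congr
    fun t ht => ?_
  rw [uIoc_of_le zero_le_one] at ht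
  have hz := hγ.mem_diff i (Ioc_subset_Icc_self ht)
  rw [stemIntegrand, (hAB _ hz).2, (hCD _ hz).2, stem_mul_stem_eq (he j)]

/-- The integral of `K₁ ds (-j) K₂` depends neither on the contour nor on `j`. -/
theorem sum_integral_stemIntegrand_eq [CompleteSpace 𝓑] (he : ∀ j, e j * e j = -1)
    (hν : ∀ j, e (ν j) = -e j) (hΩ : IsOpen (X \ N)) (hconj : ∀ z ∈ X \ N, conj z ∈ X \ N)
    (h₁ : IsRightStemOn e (X \ N) K₁) (h₂ : IsLeftStemOn e (X \ N) K₂)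
    (hK₁ : ∀ j z, K₁ (ν j) z = K₁ j (conj z)) (hK₂ : ∀ j z, K₂ (ν j) z = K₂ j (conj z))
    (hγ : IsSymmetricContour X N S γ) (hγ' : IsSymmetricContour X N S' γ') (j j' : σ) :
    ∑ i, ∫ t in (0 : ℝ)..1, stemIntegrand e K₁ K₂ j (γ i) t =
      ∑ i, ∫ t in (0 : ℝ)..1, stemIntegrand e K₁ K₂ j' (γ' i) t := by
  have hint := fun j i => intervalIntegrable_stemIntegrand he h₁ h₂ hγ j i
  have hint' := fun j i => intervalIntegrable_stemIntegrand he h₁ h₂ hγ' j i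
  obtain ⟨A, B, hAB⟩ := h₁
  obtain ⟨C, D, hCD⟩ := h₂
  have : Nonempty σ := ⟨j⟩
  have hABc : ∀ z ∈ X \ N, A (conj z) = A z ∧ B (conj z) = -B z := fun z hz =>
    stem_conj_eq (L := fun j => AddMonoidHom.mulRight (e j)) (fun j x => by simp [mul_assoc, he])
      (fun j x => by simp [hν]) hconj hK₁ (fun z hz j => (hAB z hz).2 j) hz
  have hCDc : ∀ z ∈ X \ N, C (conj z) = C z ∧ D (conj z) = -D z := fun z hz =>
    stem_conj_eq (L := fun j => AddMonoidHom.mulLeft (e j))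
      (fun j x => by simp [← mul_assoc, he]) (fun j x => by simp [hν]) hconj hK₂
      (fun z hz j => (hCD z hz).2 j) hz
  rw [SeparatingDual.eq_iff_forall_dual_eq (R := ℝ)]
  intro ℓ
  -- The functional ℓ applied to (A + iB) c (C + iD): a scalar holomorphic function, with conjugate
  -- values at conjugate points by the even-odd relations.
  let H : 𝓑 → ℂ → ℂ := fun c z => (ℓ (A z * c * C z - B z * c * D z) : ℂ) +
    ℓ (A z * c * D z + B z * c * C z) * Complex.I
  have hH : ∀ c, DifferentiableOn ℂ (H c) (X \ N) := fun c z hz =>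
    ((((hAB z hz).1.mul_const c).mul (hCD z hz).1).differentiableAt_dual ℓ).differentiableWithinAt
  have hHc : ∀ c, ∀ z ∈ X \ N, H c (conj z) = conj (H c z) := by
    intro c z hz
    simp only [H, (hABc z hz).1, (hABc z hz).2, (hCDc z hz).1, (hCDc z hz).2]
    apply Complex.ext
    · simp
    · simp
      ring
  have hpoint : ∀ {m : ℕ} {S : Set ℂ} {γ : Fin m → ℝ → ℂ}, IsSymmetricContour X N S γ →
      (∀ j i, IntervalIntegrable (stemIntegrand e K₁ K₂ j (γ i)) volume 0 1) → ∀ j,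
      ℓ (∑ i, ∫ t in (0 : ℝ)..1, stemIntegrand e K₁ K₂ j (γ i) t) =
        (∑ i, ∫ t in (0 : ℝ)..1, H 1 (γ i t) * deriv (γ i) t).im := by
    intro m S γ hγ hint j
    have hHint : ∀ c i, IntervalIntegrable (fun t => H c (γ i t) * deriv (γ i) t) volume 0 1 := by
      intro c i
      refine (hγ.intervalIntegrable_deriv i).continuousOn_mul ?_
      rw [uIcc_of_le zero_le_one]
      exact (hH c).continuousOn.comp (hγ.continuousOn i) fun t ht => hγ.mem_diff i ht
    -- The part that involves `e j` is the real part of this integral and vanishes by symmetry; what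
    -- remains, the imaginary part for c = 1, is free of j.
    have hre := hγ.re_sum_integral_eq_zero hΩ (hH (e j)) hconj (hHc (e j))
    refine Eq.trans ?_ (sub_zero (∑ i, ∫ t in (0 : ℝ)..1, H 1 (γ i t) * deriv (γ i) t).im)
    refine Eq.trans ?_ (congrArg _ hre)
    rw [map_sum, Complex.im_sum, Complex.re_sum, ← Finset.sum_sub_distrib]
    refine Finset.sum_congr rfl fun i _ => ?_
    rw [← ℓ.intervalIntegral_comp_comm (hint j i), ← Complex.imCLM_apply, ← Complex.reCLM_apply,
      ← Complex.imCLM.intervalIntegral_comp_comm (hHint 1 i),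
      ← Complex.reCLM.intervalIntegral_comp_comm (hHint (e j) i), ← intervalIntegral.integral_sub]
    · refine intervalIntegral.integral_congr fun t ht => ?_
      rw [uIcc_of_le zero_le_one] at ht
      have hz := hγ.mem_diff i ht
      simp only [stemIntegrand, (hAB _ hz).2, (hCD _ hz).2, stem_mul_stem_eq (he j), H,
        Complex.imCLM_apply, Complex.reCLM_apply]
      simp only [map_add, map_sub, map_smul, smul_eq_mul, Complex.mul_im, Complex.mul_re,
        Complex.add_re, Complex.add_im, Complex.ofReal_re,
        Complex.ofReal_im, Complex.I_re, Complex.I_im]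
      simp
      ring
    · exact ⟨Complex.imCLM.integrable_comp (hHint 1 i).1,
        Complex.imCLM.integrable_comp (hHint 1 i).2⟩
    · exact ⟨Complex.reCLM.integrable_comp (hHint _ i).1,
        Complex.reCLM.integrable_comp (hHint _ i).2⟩
  rw [hpoint hγ hint j, hpoint hγ' hint' j', hγ.sum_integral_eq hγ' hΩ (hH 1)]

end Core

/-! ### The Clifford algebra acting on `V₅` -/

namespace FineStructure

/-- Factors with index in A ∩ B occur twice on the right and square to 1. -/
lemma prod_symmDiff_of_mul_self {ι : Type*} [DecidableEq ι] [Fintype ι] {χ : ι → ℝ}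
    (hχ : ∀ i, χ i * χ i = 1) (A B : Finset ι) :
    ∏ i ∈ symmDiff A B, χ i = (∏ i ∈ A, χ i) * ∏ i ∈ B, χ i := by
  have h : ∀ S : Finset ι, ∏ i ∈ S, χ i = ∏ i, if i ∈ S then χ i else 1 := fun S => by simp
  rw [h, h A, h B, ← Finset.prod_mul_distrib]
  refine Finset.prod_congr rfl fun i _ => ?_
  by_cases hA : i ∈ A <;> by_cases hB : i ∈ B <;> simp [Finset.mem_symmDiff, hA, hB, hχ]

lemma prod_mul_self_eq_one {ι : Type*} {χ : ι → ℝ} (hχ : ∀ i, χ i * χ i = 1) (A : Finset ι) :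
    (∏ i ∈ A, χ i) * ∏ i ∈ A, χ i = 1 := by
  rw [← Finset.prod_mul_distrib]
  exact Finset.prod_eq_one fun i _ => hχ i

/-- The sign is multiplicative in each argument with respect to ∆. This is all that associativity of
the Clifford product requires of it. -/
lemma sgn_symmDiff_left (A B C : Finset (Fin 5)) :
    sgn (symmDiff A B) C = sgn A C * sgn B C :=
  prod_symmDiff_of_mul_self (fun i => prod_mul_self_eq_one (fun j => by split_ifs <;> norm_num) C)
    A B

lemma sgn_symmDiff_right (A B C : Finset (Fin 5)) :
    sgn A (symmDiff B C) = sgn A B * sgn A C := by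
  simp only [sgn]
  rw [← Finset.prod_mul_distrib]
  exact Finset.prod_congr rfl fun i _ =>
    prod_symmDiff_of_mul_self (fun j => by split_ifs <;> norm_num) B C

variable {V : Type*} [NormedAddCommGroup V] [NormedSpace ℝ V]

/-- For fixed A, the reindexing D ↦ A ∆ D matches the terms of the two double sums, and the signs
agree by bimultiplicativity and sgn² = 1. -/
lemma lmul_mul (a b : Cl5) : lmul (V := V) (Cl5.mul a b) = lmul a * lmul b := by
  ext v C
  change lmul (Cl5.mul a b) v C = lmul a (lmul b v) C
  rw [lmul_apply, lmul_apply]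
  simp only [Cl5.mul, lmul_apply, Finset.mul_sum, Finset.sum_smul, Finset.smul_sum, smul_eq_mul]
  rw [Finset.sum_comm]
  refine Finset.sum_congr rfl fun A _ => ?_
  have hinv : Function.Involutive (fun B : Finset (Fin 5) => symmDiff A B) := fun B => by
    simp [symmDiff_symmDiff_cancel_left]
  refine Fintype.sum_equiv hinv.toPerm _ _ fun D => ?_
  simp only [Function.Involutive.coe_toPerm]
  have h1 : symmDiff (symmDiff A D) (symmDiff A C) = symmDiff D C := by
    rw [symmDiff_comm A D, symmDiff_assoc, symmDiff_symmDiff_cancel_left]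
  have hs : sgn D (symmDiff D C) * sgn A (symmDiff A D) =
      sgn A (symmDiff A C) * sgn (symmDiff A D) (symmDiff D C) := by
    have h2 : sgn A C * sgn A C = 1 := by
      rw [← sgn_symmDiff_right, symmDiff_self]; simp [sgn]
    simp only [sgn_symmDiff_left, sgn_symmDiff_right]
    linear_combination -(sgn D D * sgn D C * sgn A A * sgn A D) * h2
  rw [h1, smul_smul]
  congr 1
  linear_combination a A * b (symmDiff A D) * hs

lemma lift_mul_lmul (B : V →L[ℝ] V) (a : Cl5) : lift B * lmul a = lmul a * lift B := by
  ext v C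
  simp [lmul_apply, lift_apply]

lemma lift_mul (B C : V →L[ℝ] V) : lift B * lift C = lift (B * C) := by
  ext v D
  simp [lift_apply]

lemma lift_neg (B : V →L[ℝ] V) : lift (-B) = -lift B := by
  ext v D
  simp [lift_apply]

lemma commute_lift_lift {B C : V →L[ℝ] V} (h : Commute B C) : Commute (lift B) (lift C) := by
  rw [Commute, SemiconjBy, lift_mul, lift_mul, h.eq]

/-! ### Representations of the Clifford algebra in a Banach algebra -/

/-- The symmetrized product of `∑ E_i F_i` and `∑ E_j G_j` for anticommuting units `E` and
commuting coefficients. -/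
lemma sum_mul_sum_add_sum_mul_sum {R ι : Type*} [Ring R] [Fintype ι] [DecidableEq ι]
    {E F G : ι → R}
    (hE : ∀ i j, E i * E j + E j * E i = if i = j then -2 else 0)
    (hFE : ∀ i j, Commute (F i) (E j)) (hGE : ∀ i j, Commute (G i) (E j))
    (hFG : ∀ i j, Commute (F i) (G j)) :
    (∑ i, E i * F i) * (∑ j, E j * G j) + (∑ j, E j * G j) * (∑ i, E i * F i) =
      -2 * ∑ i, F i * G i := by
  rw [Finset.sum_mul_sum, Finset.sum_mul_sum, Finset.sum_comm (s := Finset.univ) (t := Finset.univ)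
    (f := fun i j => E i * G i * (E j * F j)), ← Finset.sum_add_distrib, Finset.mul_sum]
  refine Finset.sum_congr rfl fun i _ => ?_
  rw [← Finset.sum_add_distrib]
  have h : ∀ j, E i * F i * (E j * G j) + E j * G j * (E i * F i) =
      (if i = j then -2 else 0) * (F i * G j) := by
    intro j
    rw [← hE, add_mul]
    congr 1
    · rw [mul_assoc, ← mul_assoc (F i), (hFE i j).eq]; simp only [mul_assoc]
    · rw [mul_assoc, ← mul_assoc (G j), (hGE j i).eq, (hFG i j).eq]; simp only [mul_assoc]
  simp [h]

lemma toCl_add (x y : Para) : (x + y).toCl = x.toCl + y.toCl := by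
  simp only [Para.toCl, PiLp.add_apply, add_smul, Finset.sum_add_distrib]; abel

lemma toCl_smul (c : ℝ) (x : Para) : (c • x).toCl = c • x.toCl := by
  simp only [Para.toCl, PiLp.smul_apply, smul_eq_mul, mul_smul, smul_add, Finset.smul_sum]

lemma toCl_single_zero : Para.toCl (EuclideanSpace.single (0 : Fin 6) (1 : ℝ)) = Cl5.e ∅ := by
  simp [Para.toCl]

lemma sum_sq_of_mem_unitSphere {J : Para} (hJ : J ∈ unitSphere) :
    ∑ j : Fin 5, J j.succ * J j.succ = 1 := by
  have h := EuclideanSpace.norm_sq_eq J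
  rw [hJ.2, Fin.sum_univ_succ, hJ.1] at h
  simp only [Real.norm_eq_abs, sq_abs] at h
  simpa [sq] using h.symm

/-- For every imaginary unit there is a nonzero vector orthogonal to it. -/
lemma exists_orthogonal (J : Para) :
    ∃ y : Para, y 0 = 0 ∧ ∑ j : Fin 5, y j.succ * J j.succ = 0 ∧
      ∑ j : Fin 5, y j.succ * y j.succ ≠ 0 := by
  let L : Para →ₗ[ℝ] ℝ × ℝ :=
    { toFun := fun y => (y 0, ∑ j : Fin 5, y j.succ * J j.succ)
      map_add' := fun x y => by simp [add_mul, Finset.sum_add_distrib]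
      map_smul' := fun c x => by simp [mul_assoc, Finset.mul_sum] }
  -- Two linear conditions on a space of dimension six.
  have hker : L.ker ≠ ⊥ := LinearMap.ker_ne_bot_of_finrank_lt (by simp)
  obtain ⟨y, hy, hy0⟩ := (Submodule.ne_bot_iff _).1 hker
  have hL : L y = 0 := hy
  have h1 : y 0 = 0 := congrArg Prod.fst hL
  refine ⟨y, h1, congrArg Prod.snd hL, fun h0 => hy0 ?_⟩
  rw [Finset.sum_eq_zero_iff_of_nonneg fun i _ => mul_self_nonneg _] at h0
  ext i
  refine Fin.cases ?_ (fun j => ?_) i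
  · simpa using h1
  · simpa using h0 j (Finset.mem_univ j)

section Rep

variable {𝓑 : Type*} [NormedRing 𝓑] [NormedAlgebra ℝ 𝓑]

/-- `M` is a unital representation of `ℝ₅` in the algebra `𝓑`. -/
structure IsCliffordRep (M : Cl5 → 𝓑) : Prop where
  map_add : ∀ a b, M (a + b) = M a + M b
  map_smul : ∀ (c : ℝ) a, M (c • a) = c • M a
  map_one : M (Cl5.e ∅) = 1
  map_mul : ∀ a b, M (Cl5.mul a b) = M a * M b

namespace IsCliffordRep

variable {M : Cl5 → 𝓑}

/-- The representation as a continuous linear map. -/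
noncomputable def toCLM (hM : IsCliffordRep M) : Cl5 →L[ℝ] 𝓑 :=
  LinearMap.toContinuousLinearMap
    { toFun := M
      map_add' := hM.map_add
      map_smul' := hM.map_smul }

lemma toCLM_apply (hM : IsCliffordRep M) (a : Cl5) : hM.toCLM a = M a := rfl

lemma e_relations (hM : IsCliffordRep M) (i j : Fin 5) :
    M (Cl5.e {i}) * M (Cl5.e {j}) + M (Cl5.e {j}) * M (Cl5.e {i}) = if i = j then -2 else 0 := by
  rw [← hM.map_mul, ← hM.map_mul, ← hM.map_add, Cl5.e_relations, hM.map_smul, hM.map_one]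
  split_ifs
  · rw [neg_smul, two_smul, one_add_one_eq_two]
  · simp

lemma map_neg (hM : IsCliffordRep M) (J : Para) : M (-J).toCl = -M J.toCl := by
  rw [← neg_one_smul ℝ J, toCl_smul, hM.map_smul, neg_one_smul]

lemma map_slicePt (hM : IsCliffordRep M) (J : Para) (z : ℂ) :
    M (slicePt J z).toCl = slicePoint (M J.toCl) z := by
  rw [slicePt, toCl_add, toCl_smul, toCl_smul, hM.map_add, hM.map_smul, hM.map_smul,
    toCl_single_zero, hM.map_one, slicePoint]

lemma map_of_im (hM : IsCliffordRep M) {x : Para} (hx : x 0 = 0) :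
    M x.toCl = ∑ j : Fin 5, M (Cl5.e {j}) * ((x j.succ : ℝ) • (1 : 𝓑)) := by
  rw [← hM.toCLM_apply, Para.toCl, hx, zero_smul, zero_add, map_sum]
  refine Finset.sum_congr rfl fun j _ => ?_
  rw [hM.toCLM_apply, hM.map_smul, mul_smul_comm, mul_one]

lemma mul_add_mul (hM : IsCliffordRep M) {x y : Para} (hx : x 0 = 0) (hy : y 0 = 0) :
    M x.toCl * M y.toCl + M y.toCl * M x.toCl =
      (2 : ℝ) • ((-∑ j : Fin 5, x j.succ * y j.succ) • (1 : 𝓑)) := by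
  rw [hM.map_of_im hx, hM.map_of_im hy, sum_mul_sum_add_sum_mul_sum hM.e_relations
    (fun i j => (Commute.one_left _).smul_left _) (fun i j => (Commute.one_left _).smul_left _)
    (fun i j => ((Commute.one_left _).smul_left _))]
  simp only [smul_mul_smul_comm, mul_one, ← Finset.sum_smul]
  rw [two_smul, neg_smul, neg_mul, two_mul, neg_add]

lemma mul_self (hM : IsCliffordRep M) {x : Para} (hx : x 0 = 0) :
    M x.toCl * M x.toCl = (-∑ j : Fin 5, x j.succ * x j.succ) • (1 : 𝓑) := by
  have h := hM.mul_add_mul hx hx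
  rw [← two_smul ℝ] at h
  exact smul_right_injective _ (two_ne_zero (α := ℝ)) h

lemma mul_self_of_mem_unitSphere (hM : IsCliffordRep M) {J : Para} (hJ : J ∈ unitSphere) :
    M J.toCl * M J.toCl = -1 := by
  rw [hM.mul_self hJ.1, sum_sq_of_mem_unitSphere hJ, neg_one_smul]

/-- For every imaginary unit there is an invertible element that anticommutes with it. -/
lemma exists_isUnit_anticommute (hM : IsCliffordRep M) {J : Para} (hJ : J ∈ unitSphere) :
    ∃ a : Cl5, IsUnit (M a) ∧ M a * M J.toCl = -(M J.toCl * M a) := by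
  -- Orthogonal vectors anticommute, and a nonzero vector squares to a nonzero real, so its inverse
  -- is a multiple of itself.
  obtain ⟨y, h1, h2, h3⟩ := exists_orthogonal J
  refine ⟨y.toCl, ?_, ?_⟩
  · have hsq := hM.mul_self h1
    set r : ℝ := -∑ j : Fin 5, y j.succ * y j.succ with hr
    have hinv : r⁻¹ * r = 1 := inv_mul_cancel₀ (neg_ne_zero.2 h3)
    exact (⟨M y.toCl, r⁻¹ • M y.toCl, by rw [mul_smul_comm, hsq, smul_smul, hinv, one_smul],
      by rw [smul_mul_assoc, hsq, smul_smul, hinv, one_smul]⟩ : 𝓑ˣ).isUnit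
  · have h := hM.mul_add_mul h1 hJ.1
    rw [h2, neg_zero, zero_smul, smul_zero] at h
    exact eq_neg_of_add_eq_zero_left h

lemma vec_mul_self (hM : IsCliffordRep M) {τ : Fin 5 → 𝓑} (hτ : ∀ i j, Commute (τ i) (τ j))
    (hτM : ∀ i a, Commute (τ i) (M a)) :
    (∑ j, M (Cl5.e {j}) * τ j) * (∑ j, M (Cl5.e {j}) * τ j) = -∑ j, τ j * τ j := by
  have h := sum_mul_sum_add_sum_mul_sum hM.e_relations (fun i j => hτM i _) (fun i j => hτM i _) hτ
  rw [← two_smul ℝ, neg_mul, two_mul, ← two_smul ℝ, ← smul_neg] at h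
  exact smul_right_injective _ (two_ne_zero (α := ℝ)) h

/-- If the quadratic polynomial is invertible at one point of a sphere, so is its norm. -/
lemma isUnit_quadNorm (hM : IsCliffordRep M) {t n : 𝓑} (ht : ∀ a, Commute t (M a))
    (hn : ∀ a, Commute n (M a)) (htn : Commute t n) {J : Para} (hJ : J ∈ unitSphere) {z : ℂ}
    (hu : IsUnit (quad t n (M J.toCl) z)) : IsUnit (quadNorm t n z) := by
  rw [← quad_mul_quad_neg (hM.mul_self_of_mem_unitSphere hJ) (ht _) (hn _) htn]
  refine hu.mul ?_
  -- Conjugation by this element fixes t and n and sends j to -j, so the values of the polynomial at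
  -- the two units are conjugate.
  obtain ⟨a, ⟨Y, hY⟩, hanti⟩ := hM.exists_isUnit_anticommute hJ
  have hx : M a * slicePoint (M J.toCl) z = slicePoint (-M J.toCl) z * M a := by
    simp only [slicePoint, mul_add, add_mul, mul_smul_comm, smul_mul_assoc, mul_one, one_mul,
      hanti, neg_mul]
  have hq : M a * quad t n (M J.toCl) z = quad t n (-M J.toCl) z * M a := by
    have hx2 : M a * slicePoint (M J.toCl) z ^ 2 = slicePoint (-M J.toCl) z ^ 2 * M a := by
      rw [sq, sq, ← mul_assoc, hx, mul_assoc, hx, mul_assoc]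
    have hx1 : M a * (slicePoint (M J.toCl) z * (t + t)) =
        slicePoint (-M J.toCl) z * (t + t) * M a := by
      rw [← mul_assoc, hx, mul_assoc, mul_assoc, ((ht a).add_left (ht a)).eq]
    rw [quad, quad, mul_add, mul_sub, hx2, hx1, ← (hn a).eq, add_mul, sub_mul]
  rw [← hY] at hq
  rw [← (Units.mul_inv_eq_iff_eq_mul Y).2 hq]
  exact (Y.isUnit.mul hu).mul Y⁻¹.isUnit

end IsCliffordRep

/-! ### The kernels -/

/-- The left kernels in terms of `x = s`, `t = T_0`, `c = T̄`, `c' = T` and `q = 𝓠⁻¹`. -/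
def kernelL (P : FineOp) (t c c' x q : 𝓑) : 𝓑 :=
  match P with
  | .D => (-4 : ℝ) • q
  | .Lap => (-8 : ℝ) • ((x - c) * q * q)
  | .LapD => (16 : ℝ) • q ^ 2
  | .Dbar => (4 : ℝ) • ((x - c) * q ^ 2 * (x - t)) + (2 : ℝ) • q
  | .DbarSq => (32 : ℝ) • ((x - c) * q ^ 3 * (x - t) ^ 2)
  | .DSq => (8 : ℝ) • ((x - c') * q * q)
  | .LapDbar => (-64 : ℝ) • ((x - c) * q ^ 3 * (x - t))

/-- The right kernels in terms of `x = s`, `t = T_0`, `c = T̄`, `c' = T` and `q = 𝓠⁻¹`. -/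
def kernelR (P : FineOp) (t c c' x q : 𝓑) : 𝓑 :=
  match P with
  | .D => (-4 : ℝ) • q
  | .Lap => (-8 : ℝ) • (q * (q * (x - c)))
  | .LapD => (16 : ℝ) • q ^ 2
  | .Dbar => (4 : ℝ) • ((x - t) * q ^ 2 * (x - c)) + (2 : ℝ) • q
  | .DbarSq => (32 : ℝ) • ((x - t) ^ 2 * q ^ 3 * (x - c))
  | .DSq => (8 : ℝ) • (q * (q * (x - c')))
  | .LapDbar => (-64 : ℝ) • ((x - t) * q ^ 3 * (x - c))

variable {σ : Type*} {e : σ → 𝓑} {Ω : Set ℂ} {K : σ → ℂ → 𝓑}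

/-- Covers every left kernel in which c or c' occurs: there the factor x - c or x - c' is leftmost
and an intrinsic function follows. -/
lemma isRightStemOn_sub_mul (he : ∀ j, e j * e j = -1) (hK : IsIntrinsicOn e Ω K) (c : 𝓑) :
    IsRightStemOn e Ω (fun j z => (slicePoint (e j) z - c) * K j z) := by
  simpa only [sub_mul] using
    (IsIntrinsicOn.slicePoint.mul he hK).isRightStemOn.sub_const_mul hK.isRightStemOn c

lemma isLeftStemOn_mul_sub (he : ∀ j, e j * e j = -1) (hK : IsIntrinsicOn e Ω K) (c : 𝓑) :
    IsLeftStemOn e Ω (fun j z => K j z * (slicePoint (e j) z - c)) := by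
  simpa only [mul_sub] using
    (hK.mul he IsIntrinsicOn.slicePoint).isLeftStemOn.sub_mul_const hK.isLeftStemOn c

lemma isRightStemOn_kernelL (he : ∀ j, e j * e j = -1) {t : 𝓑} (ht : ∀ j, Commute t (e j))
    (hK : IsIntrinsicOn e Ω K) (P : FineOp) (c c' : 𝓑) :
    IsRightStemOn e Ω (fun j z => kernelL P t c c' (slicePoint (e j) z) (K j z)) := by
  have hxt : IsIntrinsicOn e Ω (fun j z => slicePoint (e j) z - t) :=
    IsIntrinsicOn.slicePoint.sub (IsIntrinsicOn.const ht)
  cases P with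
  | D => exact (hK.const_smul _).isRightStemOn
  | Lap =>
    simpa only [kernelL, mul_assoc, mul_smul_comm] using
      isRightStemOn_sub_mul he ((hK.mul he hK).const_smul (-8)) c
  | LapD => exact ((hK.pow he 2).const_smul _).isRightStemOn
  | Dbar =>
    simpa only [kernelL, mul_assoc, mul_smul_comm] using
      (isRightStemOn_sub_mul he (((hK.pow he 2).mul he hxt).const_smul 4) c).add
        (hK.const_smul 2).isRightStemOn
  | DbarSq =>
    simpa only [kernelL, mul_assoc, mul_smul_comm] using
      isRightStemOn_sub_mul he (((hK.pow he 3).mul he (hxt.pow he 2)).const_smul 32) c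
  | DSq =>
    simpa only [kernelL, mul_assoc, mul_smul_comm] using
      isRightStemOn_sub_mul he ((hK.mul he hK).const_smul 8) c'
  | LapDbar =>
    simpa only [kernelL, mul_assoc, mul_smul_comm] using
      isRightStemOn_sub_mul he (((hK.pow he 3).mul he hxt).const_smul (-64)) c

lemma isLeftStemOn_kernelR (he : ∀ j, e j * e j = -1) {t : 𝓑} (ht : ∀ j, Commute t (e j))
    (hK : IsIntrinsicOn e Ω K) (P : FineOp) (c c' : 𝓑) :
    IsLeftStemOn e Ω (fun j z => kernelR P t c c' (slicePoint (e j) z) (K j z)) := by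
  have hxt : IsIntrinsicOn e Ω (fun j z => slicePoint (e j) z - t) :=
    IsIntrinsicOn.slicePoint.sub (IsIntrinsicOn.const ht)
  cases P with
  | D => exact (hK.const_smul _).isLeftStemOn
  | Lap =>
    simpa only [kernelR, mul_assoc, smul_mul_assoc] using
      isLeftStemOn_mul_sub he ((hK.mul he hK).const_smul (-8)) c
  | LapD => exact ((hK.pow he 2).const_smul _).isLeftStemOn
  | Dbar =>
    simpa only [kernelR, mul_assoc, smul_mul_assoc] using
      (isLeftStemOn_mul_sub he ((hxt.mul he (hK.pow he 2)).const_smul 4) c).add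
        (hK.const_smul 2).isLeftStemOn
  | DbarSq =>
    simpa only [kernelR, mul_assoc, smul_mul_assoc] using
      isLeftStemOn_mul_sub he (((hxt.pow he 2).mul he (hK.pow he 3)).const_smul 32) c
  | DSq =>
    simpa only [kernelR, mul_assoc, smul_mul_assoc] using
      isLeftStemOn_mul_sub he ((hK.mul he hK).const_smul 8) c'
  | LapDbar =>
    simpa only [kernelR, mul_assoc, smul_mul_assoc] using
      isLeftStemOn_mul_sub he ((hxt.mul he (hK.pow he 3)).const_smul (-64)) c

/-! ### Slice hyperholomorphic functions as stems -/

/-- A pair of functions on `ℝ²` that solves the Cauchy-Riemann system is a holomorphic pair. -/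
lemma IsCRPair.holPairAt {M : Cl5 → 𝓑} (hM : IsCliffordRep M) {W : Set Para} {α β : ℝ × ℝ → Cl5}
    (h : IsCRPair W α β) {z : ℂ} (hz : (z.re, z.im) ∈ planeSet W) :
    HolPairAt (fun z => M (α (z.re, z.im))) (fun z => M (β (z.re, z.im))) z := by
  have key : ∀ φ : ℝ × ℝ → Cl5, DifferentiableAt ℝ φ (z.re, z.im) →
      HasFDerivAt (fun z : ℂ => M (φ (z.re, z.im)))
        (hM.toCLM ∘L fderiv ℝ φ (z.re, z.im) ∘L Complex.equivRealProdCLM.toContinuousLinearMap)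
        z := by
    intro φ hφ
    have h1 : HasFDerivAt (fun z : ℂ => (z.re, z.im))
        Complex.equivRealProdCLM.toContinuousLinearMap z :=
      Complex.equivRealProdCLM.toContinuousLinearMap.hasFDerivAt
    exact hM.toCLM.hasFDerivAt.comp z (HasFDerivAt.comp z hφ.hasFDerivAt h1)
  have hlin : ∀ (L : ℝ × ℝ →L[ℝ] Cl5) (w : ℂ),
      (hM.toCLM ∘L L ∘L Complex.equivRealProdCLM.toContinuousLinearMap) w =
        w.re • M (L (1, 0)) + w.im • M (L (0, 1)) := by
    intro L w
    have hw : Complex.equivRealProdCLM w =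
        w.re • ((1 : ℝ), (0 : ℝ)) + w.im • ((0 : ℝ), (1 : ℝ)) := by
      simp
    change hM.toCLM (L (Complex.equivRealProdCLM w)) = _
    rw [hw, L.map_add, L.map_smul, L.map_smul, hM.toCLM_apply, hM.map_add, hM.map_smul,
      hM.map_smul]
  have h1 := sub_eq_zero.1 (h.cr_one _ hz)
  have h2 := eq_neg_of_add_eq_zero_left (h.cr_two _ hz)
  refine ⟨M (fderiv ℝ α (z.re, z.im) (1, 0)), M (fderiv ℝ β (z.re, z.im) (1, 0)), _, _,
    key α (h.diff_left _ hz), key β (h.diff_right _ hz), fun w => ?_, fun w => ?_⟩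
  · rw [hlin, h2, ← hM.toCLM_apply (-_), _root_.map_neg, hM.toCLM_apply, smul_neg, sub_eq_add_neg]
  · rw [hlin, h1]

/-- The imaginary units in `𝓑`. -/
def unitsIn (M : Cl5 → 𝓑) (J : unitSphere) : 𝓑 := M J.1.toCl

lemma IsLeftSliceHyperholomorphic.isLeftStemOn {M : Cl5 → 𝓑} (hM : IsCliffordRep M)
    {W : Set Para} {f : Para → Cl5} (hf : IsLeftSliceHyperholomorphic W f)
    (hΩ : ∀ z ∈ Ω, (z.re, z.im) ∈ planeSet W) :
    IsLeftStemOn (unitsIn M) Ω (fun J z => M (f (slicePt J.1 z))) := by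
  obtain ⟨_, _, α, β, hαβ, hfe⟩ := hf
  refine ⟨_, _, fun z hz => ⟨hαβ.holPairAt hM (hΩ z hz), fun J => ?_⟩⟩
  beta_reduce
  rw [hfe z.re z.im (hΩ z hz) J.1 J.2, hM.map_add, hM.map_mul, unitsIn]

lemma IsRightSliceHyperholomorphic.isRightStemOn {M : Cl5 → 𝓑} (hM : IsCliffordRep M)
    {W : Set Para} {f : Para → Cl5} (hf : IsRightSliceHyperholomorphic W f)
    (hΩ : ∀ z ∈ Ω, (z.re, z.im) ∈ planeSet W) :
    IsRightStemOn (unitsIn M) Ω (fun J z => M (f (slicePt J.1 z))) := by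
  obtain ⟨_, _, α, β, hαβ, hfe⟩ := hf
  refine ⟨_, _, fun z hz => ⟨hαβ.holPairAt hM (hΩ z hz), fun J => ?_⟩⟩
  beta_reduce
  rw [hfe z.re z.im (hΩ z hz) J.1 J.2, hM.map_add, hM.map_mul, unitsIn]

end Rep

/-! ### The operators `T`, its conjugate and `𝓠_{c,s}(T)` -/

section Operators

variable {V : Type*} [NormedAddCommGroup V] [NormedSpace ℝ V]

lemma isCliffordRep_lmul : IsCliffordRep (fun a => (lmul a : V5 V →L[ℝ] V5 V)) where
  map_add a b := by
    ext v C
    simp [lmul_apply, mul_add, add_smul, Finset.sum_add_distrib]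
  map_smul c a := by
    ext v C
    change lmul (c • a) v C = c • lmul a v C
    simp [lmul_apply, Finset.smul_sum, smul_smul, mul_left_comm]
  map_one := lmul_one
  map_mul := lmul_mul

variable {T : Fin 6 → (V →L[ℝ] V)}

/-- The operator `T T̄ = T_0 ^ 2 + T_1 ^ 2 + ⋯ + T_5 ^ 2`. -/
noncomputable def opNormSq (T : Fin 6 → (V →L[ℝ] V)) : V5 V →L[ℝ] V5 V :=
  lift (T 0) * lift (T 0) + ∑ j : Fin 5, lift (T j.succ) * lift (T j.succ)

lemma opT_conjT_eq (T : Fin 6 → (V →L[ℝ] V)) :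
    opT (conjT T) = lift (T 0) - ∑ j : Fin 5, lmul (Cl5.e {j}) * lift (T j.succ) := by
  have h0 : conjT T 0 = T 0 := by simp [conjT]
  have h : ∀ j : Fin 5, lmul (Cl5.e {j}) * lift (conjT T j.succ) =
      -(lmul (Cl5.e {j}) * lift (T j.succ)) := fun j => by
    rw [show conjT T j.succ = -T j.succ by simp [conjT, Fin.succ_ne_zero], lift_neg]
    exact mul_neg (lmul (Cl5.e {j}) : V5 V →L[ℝ] V5 V) (lift (T j.succ))
  rw [opT, h0, Finset.sum_congr rfl fun j _ => h j, Finset.sum_neg_distrib, sub_eq_add_neg]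

lemma conjT_conjT (T : Fin 6 → (V →L[ℝ] V)) : conjT (conjT T) = T := by
  funext i
  by_cases hi : i = 0 <;> simp [conjT, hi]

lemma commute_lift_vec (hT : ∀ i j, Commute (T i) (T j)) :
    Commute (lift (T 0)) (∑ j : Fin 5, lmul (Cl5.e {j}) * lift (T j.succ)) :=
  Commute.sum_right _ _ _ fun _ _ =>
    Commute.mul_right (lift_mul_lmul _ _) (commute_lift_lift (hT _ _))

lemma vec_mul_self (hT : ∀ i j, Commute (T i) (T j)) :
    (∑ j : Fin 5, lmul (Cl5.e {j}) * lift (T j.succ)) *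
      (∑ j : Fin 5, lmul (Cl5.e {j}) * lift (T j.succ)) =
      -∑ j : Fin 5, lift (T j.succ) * lift (T j.succ) :=
  isCliffordRep_lmul.vec_mul_self (τ := fun j => lift (T j.succ))
    (fun _ _ => commute_lift_lift (hT _ _)) (fun _ _ => lift_mul_lmul _ _)

/-- For T = T_0 + v the product is T_0² - v², and the mixed terms of v² cancel by anticommutation.
-/
lemma opT_mul_opT_conjT (hT : ∀ i j, Commute (T i) (T j)) :
    opT T * opT (conjT T) = opNormSq T := by
  rw [opT_conjT_eq, opT, ← (commute_lift_vec hT).mul_self_sub_mul_self_eq,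
    vec_mul_self hT, sub_neg_eq_add, opNormSq]

lemma opT_conjT_mul_opT (hT : ∀ i j, Commute (T i) (T j)) :
    opT (conjT T) * opT T = opNormSq T := by
  rw [opT_conjT_eq, opT, ← (commute_lift_vec hT).mul_self_sub_mul_self_eq',
    vec_mul_self hT, sub_neg_eq_add, opNormSq]

lemma commute_lift_opNormSq (hT : ∀ i j, Commute (T i) (T j)) :
    Commute (lift (T 0)) (opNormSq T) := by
  have h : ∀ i, Commute (lift (T 0)) (lift (T i)) := fun i => commute_lift_lift (hT _ _)
  exact ((h 0).mul_right (h 0)).add_right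
    (Commute.sum_right _ _ _ fun _ _ => (h _).mul_right (h _))

lemma commute_opNormSq_lmul (a : Cl5) : Commute (opNormSq T) (lmul a) := by
  have h : ∀ i, Commute (lift (T i)) (lmul a) := fun i => lift_mul_lmul _ _
  exact ((h 0).mul_left (h 0)).add_left
    (Commute.sum_left _ _ _ fun _ _ => (h _).mul_left (h _))

/-- The units cancel in T + T̄ and in T T̄, so the coefficients of the polynomial commute with all
of ℝ₅. -/
lemma Qc_slicePt (hT : ∀ i j, Commute (T i) (T j)) (J : Para) (z : ℂ) :
    Qc (slicePt J z) T = quad (lift (T 0)) (opNormSq T) (lmul J.toCl) z := by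
  have h : Qc (slicePt J z) T = scal V (slicePt J z) ^ 2 -
      scal V (slicePt J z) * (lift (T 0) + lift (T 0)) + opNormSq T := by
    rw [Qc, opT_mul_opT_conjT hT, opT_conjT_eq, opT, add_add_sub_cancel]
  rw [h, quad, ← (isCliffordRep_lmul (V := V)).map_slicePt J z]
  simp only [scal]

lemma Qc_conjT (hT : ∀ i j, Commute (T i) (T j)) (s : Para) : Qc s (conjT T) = Qc s T := by
  rw [Qc, Qc, conjT_conjT, opT_conjT_mul_opT hT, opT_mul_opT_conjT hT, add_comm (opT T)]

lemma resolventL_eq (hT : ∀ i j, Commute (T i) (T j)) (P : FineOp) (J : Para) (z : ℂ) :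
    resolventL P (slicePt J z) T = kernelL P (lift (T 0)) (opT (conjT T)) (opT T)
      (slicePoint (lmul J.toCl) z)
      (Ring.inverse (quad (lift (T 0)) (opNormSq T) (lmul J.toCl) z)) := by
  rw [← Qc_slicePt hT, ← (isCliffordRep_lmul (V := V)).map_slicePt J z]
  change _ = kernelL P (lift (T 0)) (opT (conjT T)) (opT T) (scal V (slicePt J z))
    (QcInv (slicePt J z) T)
  have hconj : QcInv (slicePt J z) (conjT T) = QcInv (slicePt J z) T := by
    rw [QcInv, QcInv, Qc_conjT hT]
  cases P <;> simp only [resolventL, kernelL, SL, hconj, conjT_conjT]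

lemma resolventR_eq (hT : ∀ i j, Commute (T i) (T j)) (P : FineOp) (J : Para) (z : ℂ) :
    resolventR P (slicePt J z) T = kernelR P (lift (T 0)) (opT (conjT T)) (opT T)
      (slicePoint (lmul J.toCl) z)
      (Ring.inverse (quad (lift (T 0)) (opNormSq T) (lmul J.toCl) z)) := by
  rw [← Qc_slicePt hT, ← (isCliffordRep_lmul (V := V)).map_slicePt J z]
  change _ = kernelR P (lift (T 0)) (opT (conjT T)) (opT T) (scal V (slicePt J z))
    (QcInv (slicePt J z) T)
  have hconj : QcInv (slicePt J z) (conjT T) = QcInv (slicePt J z) T := by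
    rw [QcInv, QcInv, Qc_conjT hT]
  cases P <;> simp only [resolventR, kernelR, SR, hconj, conjT_conjT]

lemma isUnit_quadNorm_of_notMem_sSpectrum (hT : ∀ i j, Commute (T i) (T j)) {J : Para}
    (hJ : J ∈ unitSphere) {z : ℂ} (hz : slicePt J z ∉ sSpectrum T) :
    IsUnit (quadNorm (lift (T 0)) (opNormSq T) z) := by
  -- An inverse in `boundedOps` is in particular one among all continuous operators, the ring to
  -- which `IsUnit` refers.
  obtain ⟨R, _, h1, h2⟩ := not_not.1 hz
  refine isCliffordRep_lmul.isUnit_quadNorm (fun a => lift_mul_lmul _ _)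
    (fun a => commute_opNormSq_lmul _) (commute_lift_opNormSq hT) hJ ?_
  rw [← Qc_slicePt hT]
  exact (⟨_, R, h1, h2⟩ : (V5 V →L[ℝ] V5 V)ˣ).isUnit

end Operators

/-! ### Slices of admissible domains -/

lemma slicePt_conj (J : Para) (z : ℂ) : slicePt J (conj z) = slicePt (-J) z := by
  simp [slicePt]

lemma neg_mem_unitSphere {J : Para} (hJ : J ∈ unitSphere) : -J ∈ unitSphere :=
  ⟨by simpa using hJ.1, by simpa using hJ.2⟩

lemma continuous_slicePt (J : Para) : Continuous (slicePt J) :=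
  (Complex.continuous_re.smul continuous_const).add (Complex.continuous_im.smul continuous_const)

lemma norm_le_of_mem_unitSphere {J : Para} (hJ : J ∈ unitSphere) (z : ℂ) :
    ‖z‖ ≤ 3 * ‖slicePt J z‖ := by
  have h0 : (slicePt J z) 0 = z.re := by simp [slicePt, hJ.1]
  have hre : |z.re| ≤ ‖slicePt J z‖ := by
    rw [← h0]; exact PiLp.norm_apply_le (slicePt J z) 0
  have him : |z.im| ≤ ‖slicePt J z‖ + |z.re| := by
    have h1 : z.im • J = slicePt J z - z.re • EuclideanSpace.single 0 (1 : ℝ) := by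
      simp [slicePt]
    have h2 := norm_sub_le (slicePt J z) (z.re • EuclideanSpace.single 0 (1 : ℝ))
    rw [← h1, norm_smul, norm_smul, hJ.2] at h2
    simpa using h2
  -- |Re z| ≤ ‖s‖ and |Im z| ≤ 2‖s‖ for s = `slicePt J z`; the crude factor 3 is enough for
  -- boundedness.
  linarith [Complex.norm_le_abs_re_add_abs_im z]

/-- The points `z` of the plane with `u + J v ∈ W` for all `J ∈ 𝕊`. -/
def planeDomain (W : Set Para) : Set ℂ := {z | (z.re, z.im) ∈ planeSet W}

lemma planeDomain_eq_slice {W : Set Para} (hW : IsAxiallySymmetric W) {J : Para}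
    (hJ : J ∈ unitSphere) : planeDomain W = slice W J :=
  Set.ext fun z => ⟨fun hz => hz J hJ, fun hz I hI => hW z J hJ hz I hI⟩

lemma isOpen_slice {U : Set Para} (hU : IsOpen U) (J : Para) : IsOpen (slice U J) :=
  hU.preimage (continuous_slicePt J)

lemma conj_mem_slice {U : Set Para} (hU : IsAxiallySymmetric U) {J : Para} (hJ : J ∈ unitSphere)
    {z : ℂ} (hz : z ∈ slice U J) : conj z ∈ slice U J := by
  change slicePt J (conj z) ∈ U
  rw [slicePt_conj]
  exact hU z J hJ hz _ (neg_mem_unitSphere hJ)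

lemma isBounded_slice {U : Set Para} (hU : Bornology.IsBounded U) {J : Para}
    (hJ : J ∈ unitSphere) : Bornology.IsBounded (slice U J) := by
  obtain ⟨C, hC⟩ := isBounded_iff_forall_norm_le.1 hU
  refine isBounded_iff_forall_norm_le.2 ⟨3 * C, fun z hz => ?_⟩
  exact (norm_le_of_mem_unitSphere hJ z).trans
    (mul_le_mul_of_nonneg_left (hC _ hz) (by norm_num))

/-! ### Admissible domains give symmetric contours in the plane -/

section Main

variable {V : Type*} [NormedAddCommGroup V] [NormedSpace ℝ V] {T : Fin 6 → (V →L[ℝ] V)}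
  {W U U' : Set Para} {J J' : Para} {n n' : ℕ} {γ : Fin n → ℝ → ℂ} {γ' : Fin n' → ℝ → ℂ}
  {f : Para → Cl5}

/-- The points of the plane that lie on the `S`-spectrum. -/
def planeSpectrum (T : Fin 6 → (V →L[ℝ] V)) : Set ℂ :=
  {z | ¬ IsUnit (quadNorm (lift (T 0)) (opNormSq T) z)}

lemma IsAdmissible.isSymmetricContour (hT : ∀ i j, Commute (T i) (T j))
    (hW : IsAxiallySymmetric W) (h : IsAdmissible T W U J γ) :
    IsSymmetricContour (planeDomain W) (planeSpectrum T) (slice U J) γ where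
  isOpen := isOpen_slice h.cauchy.1 J
  bounded := isBounded_slice h.bounded h.unit
  subset := fun z hz => by
    by_contra hzU
    exact hz (isUnit_quadNorm_of_notMem_sSpectrum hT h.unit fun hs => hzU (h.spectrum_subset hs))
  closure_subset := by
    rw [planeDomain_eq_slice hW h.unit]
    intro z hz
    exact h.closure_subset (map_mem_closure (continuous_slicePt J) hz fun w hw => hw)
  conj_mem := fun z hz => conj_mem_slice h.cauchy.2.1 h.unit hz
  positive := h.positive

/-- The units of a Banach algebra form an open set and `quadNorm` is continuous in z, so the
spectral set is closed. -/
lemma isOpen_planeDomain_diff [CompleteSpace V] (hW : IsOpen W) (hWa : IsAxiallySymmetric W)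
    (hJ : J ∈ unitSphere) : IsOpen (planeDomain W \ planeSpectrum T) := by
  rw [planeDomain_eq_slice hWa hJ]
  have h : IsClosed (planeSpectrum T) := by
    rw [← isOpen_compl_iff]
    have h1 := isOpen_isUnit_quadNorm (lift (T 0)) (opNormSq T)
    have h2 : (planeSpectrum T)ᶜ = {z | IsUnit (quadNorm (lift (T 0)) (opNormSq T) z)} := by
      ext z; exact not_not
    rw [h2]
    exact h1
  exact (isOpen_slice hW J).sdiff h

lemma conj_mem_planeDomain_diff (hWa : IsAxiallySymmetric W) (hJ : J ∈ unitSphere) {z : ℂ}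
    (hz : z ∈ planeDomain W \ planeSpectrum T) : conj z ∈ planeDomain W \ planeSpectrum T := by
  rw [planeDomain_eq_slice hWa hJ] at hz ⊢
  refine ⟨conj_mem_slice hWa hJ hz.1, fun h => hz.2 ?_⟩
  have h1 : quadNorm (lift (T 0)) (opNormSq T) (conj z) =
      quadNorm (lift (T 0)) (opNormSq T) z := quadNorm_conj _ _ z
  intro hu
  exact h (h1 ▸ hu)

end Main

/-! ### The functional calculi as integrals of stems -/

section Calculus

variable {V : Type*} [NormedAddCommGroup V] [NormedSpace ℝ V] {T : Fin 6 → (V →L[ℝ] V)}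
  {W U U' : Set Para} {J J' : Para} {n n' : ℕ} {γ : Fin n → ℝ → ℂ} {γ' : Fin n' → ℝ → ℂ}
  {f : Para → Cl5}

/-- The imaginary units as operators on `V₅`. -/
noncomputable def unitOp (V : Type*) [NormedAddCommGroup V] [NormedSpace ℝ V] :
    unitSphere → (V5 V →L[ℝ] V5 V) :=
  unitsIn fun a => (lmul a : V5 V →L[ℝ] V5 V)

/-- The antipodal map of `𝕊`. -/
def antipode (J : unitSphere) : unitSphere := ⟨-J.1, neg_mem_unitSphere J.2⟩

lemma unitOp_mul_self (J : unitSphere) : unitOp V J * unitOp V J = -1 :=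
  isCliffordRep_lmul.mul_self_of_mem_unitSphere J.2

lemma unitOp_antipode (J : unitSphere) : unitOp V (antipode J) = -unitOp V J :=
  isCliffordRep_lmul.map_neg J.1

lemma isIntrinsicOn_inverse_quad_unitOp [CompleteSpace V] (hT : ∀ i j, Commute (T i) (T j))
    (J : unitSphere) (X : Set ℂ) :
    IsIntrinsicOn (unitOp V) (X \ planeSpectrum T)
      (fun J z => Ring.inverse (quad (lift (T 0)) (opNormSq T) (unitOp V J) z)) :=
  have : Nonempty unitSphere := ⟨J⟩
  isIntrinsicOn_inverse_quad unitOp_mul_self (fun _ => lift_mul_lmul _ _)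
    (fun _ => commute_opNormSq_lmul _) (commute_lift_opNormSq hT) fun _ hz => not_not.1 hz.2

lemma isRightStemOn_resolventL [CompleteSpace V] (hT : ∀ i j, Commute (T i) (T j)) (P : FineOp)
    (J : unitSphere) (X : Set ℂ) :
    IsRightStemOn (unitOp V) (X \ planeSpectrum T)
      (fun J z => resolventL P (slicePt J.1 z) T) := by
  simp only [resolventL_eq hT]
  exact isRightStemOn_kernelL (e := unitOp V) (t := lift (T 0)) unitOp_mul_self
    (fun _ => lift_mul_lmul _ _) (isIntrinsicOn_inverse_quad_unitOp hT J X) P _ _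

lemma isLeftStemOn_resolventR [CompleteSpace V] (hT : ∀ i j, Commute (T i) (T j)) (P : FineOp)
    (J : unitSphere) (X : Set ℂ) :
    IsLeftStemOn (unitOp V) (X \ planeSpectrum T)
      (fun J z => resolventR P (slicePt J.1 z) T) := by
  simp only [resolventR_eq hT]
  exact isLeftStemOn_kernelR (e := unitOp V) (t := lift (T 0)) unitOp_mul_self
    (fun _ => lift_mul_lmul _ _) (isIntrinsicOn_inverse_quad_unitOp hT J X) P _ _

lemma differential_eq (J : unitSphere) (w : ℂ) :
    scal V (slicePt J.1 w) * scal V (-J.1) = slicePoint (unitOp V J) w * -unitOp V J := by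
  rw [show scal V (slicePt J.1 w) = slicePoint (unitOp V J) w from
    (isCliffordRep_lmul (V := V)).map_slicePt J.1 w,
    show scal V (-J.1) = -unitOp V J from (isCliffordRep_lmul (V := V)).map_neg J.1]

lemma integrandL_eq (P : FineOp) (T : Fin 6 → (V →L[ℝ] V)) (f : Para → Cl5) (J : unitSphere)
    (γ : ℝ → ℂ) : integrandL P T f J.1 γ =
      stemIntegrand (unitOp V) (fun J z => resolventL P (slicePt J.1 z) T)
        (fun J z => lmul (f (slicePt J.1 z))) J γ := by
  funext t
  rw [integrandL, differential_eq]
  rfl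

lemma integrandR_eq (P : FineOp) (T : Fin 6 → (V →L[ℝ] V)) (f : Para → Cl5) (J : unitSphere)
    (γ : ℝ → ℂ) : integrandR P T f J.1 γ =
      stemIntegrand (unitOp V) (fun J z => lmul (f (slicePt J.1 z)))
        (fun J z => resolventR P (slicePt J.1 z) T) J γ := by
  funext t
  rw [integrandR, differential_eq]
  rfl

lemma intervalIntegrable_integrandL [CompleteSpace V] (hT : ∀ i j, Commute (T i) (T j))
    (P : FineOp) (hf : IsLeftSliceHyperholomorphic W f) (h : IsAdmissible T W U J γ) (i : Fin n) :
    IntervalIntegrable (integrandL P T f J (γ i)) volume 0 1 := by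
  rw [integrandL_eq P T f ⟨J, h.unit⟩]
  exact intervalIntegrable_stemIntegrand unitOp_mul_self
    (isRightStemOn_resolventL hT P ⟨J, h.unit⟩ _)
    (hf.isLeftStemOn (isCliffordRep_lmul (V := V)) fun z hz => hz.1)
    (h.isSymmetricContour hT hf.2.1) _ i

lemma intervalIntegrable_integrandR [CompleteSpace V] (hT : ∀ i j, Commute (T i) (T j))
    (P : FineOp) (hf : IsRightSliceHyperholomorphic W f) (h : IsAdmissible T W U J γ) (i : Fin n) :
    IntervalIntegrable (integrandR P T f J (γ i)) volume 0 1 := by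
  rw [integrandR_eq P T f ⟨J, h.unit⟩]
  exact intervalIntegrable_stemIntegrand unitOp_mul_self
    (hf.isRightStemOn (isCliffordRep_lmul (V := V)) fun z hz => hz.1)
    (isLeftStemOn_resolventR hT P ⟨J, h.unit⟩ _) (h.isSymmetricContour hT hf.2.1) _ i

lemma calcL_eq_calcL [CompleteSpace V] (hT : ∀ i j, Commute (T i) (T j)) (P : FineOp)
    (hf : IsLeftSliceHyperholomorphic W f) (h : IsAdmissible T W U J γ)
    (h' : IsAdmissible T W U' J' γ') : calcL P T f J γ = calcL P T f J' γ' := by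
  have key := sum_integral_stemIntegrand_eq (unitOp_mul_self (V := V)) unitOp_antipode
    (isOpen_planeDomain_diff (T := T) hf.1 hf.2.1 h.unit)
    (fun z hz => conj_mem_planeDomain_diff hf.2.1 h.unit hz)
    (isRightStemOn_resolventL hT P ⟨J, h.unit⟩ _)
    (hf.isLeftStemOn (isCliffordRep_lmul (V := V)) fun z hz => hz.1)
    -- Both factors depend on (J, z) only through the point u + Jv, and u + J(-v) = u + (-J)v.
    (fun K z => by rw [slicePt_conj]; rfl) (fun K z => by rw [slicePt_conj]; rfl)
    (h.isSymmetricContour hT hf.2.1) (h'.isSymmetricContour hT hf.2.1) ⟨J, h.unit⟩ ⟨J', h'.unit⟩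
  simp only [calcL, integrandL_eq P T f ⟨J, h.unit⟩, integrandL_eq P T f ⟨J', h'.unit⟩]
  exact congrArg _ key

lemma calcR_eq_calcR [CompleteSpace V] (hT : ∀ i j, Commute (T i) (T j)) (P : FineOp)
    (hf : IsRightSliceHyperholomorphic W f) (h : IsAdmissible T W U J γ)
    (h' : IsAdmissible T W U' J' γ') : calcR P T f J γ = calcR P T f J' γ' := by
  have key := sum_integral_stemIntegrand_eq (unitOp_mul_self (V := V)) unitOp_antipode
    (isOpen_planeDomain_diff (T := T) hf.1 hf.2.1 h.unit)
    (fun z hz => conj_mem_planeDomain_diff hf.2.1 h.unit hz)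
    (hf.isRightStemOn (isCliffordRep_lmul (V := V)) fun z hz => hz.1)
    (isLeftStemOn_resolventR hT P ⟨J, h.unit⟩ _)
    (fun K z => by rw [slicePt_conj]; rfl) (fun K z => by rw [slicePt_conj]; rfl)
    (h.isSymmetricContour hT hf.2.1) (h'.isSymmetricContour hT hf.2.1) ⟨J, h.unit⟩ ⟨J', h'.unit⟩
  simp only [calcR, integrandR_eq P T f ⟨J, h.unit⟩, integrandR_eq P T f ⟨J', h'.unit⟩]
  exact congrArg _ key

end Calculus

end FineStructure

end Development

theorem mainTheorem3 {V : Type*} [NormedAddCommGroup V] [NormedSpace ℝ V] [CompleteSpace V]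
    (T : Fin 6 → (V →L[ℝ] V)) (hT : ∀ i j, Commute (T i) (T j))
    (P : FineOp) (W : Set Para) (f : Para → Cl5) :
    (IsLeftSliceHyperholomorphic W f →
      (∀ (U : Set Para) (J : Para) (n : ℕ) (γ : Fin n → ℝ → ℂ), IsAdmissible T W U J γ →
        ∀ i, IntervalIntegrable (integrandL P T f J (γ i)) MeasureTheory.volume 0 1) ∧
      (∀ (U U' : Set Para) (J J' : Para) (n n' : ℕ) (γ : Fin n → ℝ → ℂ) (γ' : Fin n' → ℝ → ℂ),
        IsAdmissible T W U J γ → IsAdmissible T W U' J' γ' →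
        calcL P T f J γ = calcL P T f J' γ')) ∧
    (IsRightSliceHyperholomorphic W f →
      (∀ (U : Set Para) (J : Para) (n : ℕ) (γ : Fin n → ℝ → ℂ), IsAdmissible T W U J γ →
        ∀ i, IntervalIntegrable (integrandR P T f J (γ i)) MeasureTheory.volume 0 1) ∧
      (∀ (U U' : Set Para) (J J' : Para) (n n' : ℕ) (γ : Fin n → ℝ → ℂ) (γ' : Fin n' → ℝ → ℂ),
        IsAdmissible T W U J γ → IsAdmissible T W U' J' γ' →
        calcR P T f J γ = calcR P T f J' γ')) := by
  exact ⟨fun hf => ⟨fun _ _ _ _ h => intervalIntegrable_integrandL hT P hf h,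
      fun _ _ _ _ _ _ _ _ h h' => calcL_eq_calcL hT P hf h h'⟩,
    fun hf => ⟨fun _ _ _ _ h => intervalIntegrable_integrandR hT P hf h,
      fun _ _ _ _ _ _ _ _ h h' => calcR_eq_calcR hT P hf h h'⟩⟩
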